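/- Let $\mathbb{S}^n\subset\mathbb{R}^{n+1}$ be the unit sphere with its canonical metric, with Levi-Civita connection $\nabla$ and curvature tensor $R_{X,Y}Z=\nabla_X\nabla_YZ-\nabla_Y\nabla_XZ-\nabla_{[X,Y]}Z$. Let $k\in\mathbb{R}$, and let $M$ be a smooth (immersed) submanifold of $\mathbb{S}^n$ of dimension $m$, with inclusion (immersion) $\varphi: M\to\mathbb{S}^n$ and induced metric $g$. Identify $TM$ with a subbundle of $\varphi^*T\mathbb{S}^n$, and let $NM$ be its orthogonal complement in $\varphi^*T\mathbb{S}^n$. All traces below are taken with respect to $g$. Write $\nabla$ also for the induced connection on $\varphi^*T\mathbb{S}^n$, $\nabla^N$ for the normal connection on $NM$ (the normal part of $\nabla$), and $\Delta=-\operatorname{tr}\nabla^2$, $\Delta^N=-\operatorname{tr}(\nabla^N)^2$ for the corresponding (nonnegative) Laplacians on sections, where second covariant derivatives also use the Levi-Civita connection of $g$. Let $B(U,V)=(\nabla_UV)^{\perp}\in NM$ be the second fundamental form, $A$ the Weingarten operator, given by $g(A_\xi U,V)=\langle B(U,V),\xi\rangle$ for $\xi\in NM$, and $H=\frac1m\operatorname{tr}B$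 the mean curvature. Let $\delta T\varphi=-\operatorname{tr}\nabla T\varphi$, and let $\mathcal{S}(X)=\operatorname{tr}R_{X,T\varphi}T\varphi$ for $X\in\varphi^*T\mathbb{S}^n$. The submanifold $M$ is called *biharmonic of index $k$* in $\mathbb{S}^n$ if $$\Delta(\delta T\varphi)-\mathcal{S}(\delta T\varphi)+k\,\delta T\varphi=0 \quad\text{on } M.$$ **Proposition.** $M$ is biharmonic of index $k$ in $\mathbb{S}^n$ if and only if both of the following equations hold on $M$: $$\Delta^N H-(m-k)\,H+\operatorname{tr}B\big(\,\cdot\,,A_H(\,\cdot\,)\big)=0,$$ $$\frac m2\,d|H|^2+2\operatorname{tr}A_{\nabla^N_{(\cdot)}H}(\,\cdot\,)=0,$$ where in the second equation the tangent vector field $\operatorname{tr}A_{\nabla^N_{(\cdot)}H}(\,\cdot\,)$ is regarded as a $1$-form by means of $g$. -/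

import Mathlib

open scoped Manifold ContDiff

noncomputable section

namespace SphereSubmanifold

/-! ### The round sphere `S^n`, with its Levi-Civita connection and its curvature tensor

`S^n` is the unit sphere of `ℝ^(n+1)` with the metric induced by the Euclidean one.  The tangent
space `T_q S^n` is identified with the orthogonal complement of `q` in `ℝ^(n+1)`. -/

/-- The Euclidean space `ℝ^(n+1)` that contains `S^n`. -/
abbrev Ambient (n : ℕ) : Type := EuclideanSpace ℝ (Fin (n + 1))

/-- The unit sphere `S^n` (a smooth manifold of dimension `n`). -/
abbrev UnitSphere (n : ℕ) : Type := Metric.sphere (0 : Ambient n) 1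

/-- Orthogonal projection of `ℝ^(n+1)` onto `T_q S^n`. -/
def sphereProj {n : ℕ} (q x : Ambient n) : Ambient n :=
  (Submodule.span ℝ {q})ᗮ.starProjection x

/-- The Levi-Civita connection of `S^n`: `∇_X Y` is the tangential part of the Euclidean
derivative of `Y` in the direction `X`.  A vector field on `S^n` is represented here by a field on
`ℝ^(n+1)` that extends it; at points of `S^n` and for `X` tangent to `S^n`, the result depends
only on the restrictions to `S^n`. -/
def sphereNabla {n : ℕ} (X Y : Ambient n → Ambient n) (q : Ambient n) : Ambient n :=
  sphereProj q (fderiv ℝ Y q (X q))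

/-- The curvature tensor `R_{X,Y} Z = ∇_X ∇_Y Z - ∇_Y ∇_X Z - ∇_{[X,Y]} Z` of `S^n` at `q ∈ S^n`,
on tangent vectors `x, y, z ∈ T_q S^n`.  The vectors are extended to the tangent vector fields
`r ↦ sphereProj r x` etc.; by tensoriality the choice of the extensions is irrelevant. -/
def sphereCurvature {n : ℕ} (q x y z : Ambient n) : Ambient n :=
  let X : Ambient n → Ambient n := fun r => sphereProj r x
  let Y : Ambient n → Ambient n := fun r => sphereProj r y
  let Z : Ambient n → Ambient n := fun r => sphereProj r z
  sphereNabla X (sphereNabla Y Z) q - sphereNabla Y (sphereNabla X Z) q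
    - sphereNabla (VectorField.lieBracket ℝ X Y) Z q

/-! ### Immersed submanifolds of `S^n` -/

variable (m : ℕ) {n : ℕ} {M : Type*} [TopologicalSpace M] [ChartedSpace (EuclideanSpace ℝ (Fin m)) M]

/-- `φ : M → S^n` is a smooth immersion, i.e. makes `M` an (immersed) submanifold of `S^n`.
For a submanifold `M ⊆ S^n` take for `φ` the inclusion. -/
structure IsImmersedSubmanifold (φ : M → UnitSphere n) : Prop where
  contMDiff : ContMDiff (𝓡 m) (𝓡 n) ∞ φ
  injective_mfderiv : ∀ p : M, Function.Injective (mfderiv (𝓡 m) (𝓡 n) φ p)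

variable (φ : M → UnitSphere n)

/-- The tangent map `Tφ` at `p`, with values in `T_{φ(p)} S^n ⊆ ℝ^(n+1)`. -/
def tangentMapAt (p : M) : TangentSpace (𝓡 m) p →L[ℝ] Ambient n :=
  mvfderiv (𝓡 m) (fun q : M => (φ q : Ambient n)) p

/-- The tangent space `T_p M`, identified through `Tφ` with a subspace of
`T_{φ(p)} S^n ⊆ ℝ^(n+1)`.  The Riemannian metric `g` of `M` is the one induced by `φ`: it is the
restriction of the Euclidean inner product to `tangentPlane m φ p`. -/
def tangentPlane (p : M) : Submodule ℝ (Ambient n) :=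
  LinearMap.range (tangentMapAt m φ p).toLinearMap

/-- The normal space `N_p M`: the orthogonal complement of `T_p M` in `T_{φ(p)} S^n`. -/
def normalPlane (p : M) : Submodule ℝ (Ambient n) :=
  (tangentPlane m φ p)ᗮ ⊓ (Submodule.span ℝ {(φ p : Ambient n)})ᗮ

/-- Orthogonal projection onto `T_p M`. -/
def tanProj (p : M) (w : Ambient n) : Ambient n := (tangentPlane m φ p).starProjection w

/-- Orthogonal projection onto `N_p M`. -/
def norProj (p : M) (w : Ambient n) : Ambient n := (normalPlane m φ p).starProjection w

/-- The tangent vector of the manifold `M` at `p` whose image under `Tφ` is the orthogonal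
projection of `w` onto `tangentPlane m φ p`; for `w ∈ tangentPlane m φ p` this inverts the
identification of `T_p M` with `tangentPlane m φ p`. -/
def tangentLift (p : M) (w : Ambient n) : TangentSpace (𝓡 m) p :=
  (tangentMapAt m φ p).toLinearMap.leftInverse (tanProj m φ p w)

/-- The derivative at `p` of a map `X : M → ℝ^(n+1)` in the direction `u ∈ T_p M`. -/
def dirDeriv (X : M → Ambient n) (p : M) (u : Ambient n) : Ambient n :=
  mvfderiv (𝓡 m) X p (tangentLift m φ p u)

/-- The vector field on `M` that extends `v ∈ T_p M`, obtained by projecting `v` onto the tangent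
spaces of `M`.  It serves to evaluate tensors on vectors. -/
def tanExtend (v : Ambient n) (q : M) : Ambient n := tanProj m φ q v

/-- The connection `∇` of `φ^* T S^n` induced by the Levi-Civita connection of `S^n`:
`∇_u X` for a section `X` of `φ^* T S^n` and `u ∈ T_p M`. -/
def nabla (X : M → Ambient n) (p : M) (u : Ambient n) : Ambient n :=
  sphereProj (φ p : Ambient n) (dirDeriv m φ X p u)

/-- The Levi-Civita connection `∇^T` of `(M, g)`: `∇^T_u U` is the tangential part of `∇_u U`,
for a vector field `U` on `M` and `u ∈ T_p M`. -/
def nablaT (U : M → Ambient n) (p : M) (u : Ambient n) : Ambient n :=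
  tanProj m φ p (nabla m φ U p u)

/-- The connection `∇^N` of the normal bundle: `∇^N_u X` is the normal part of `∇_u X`, for a
section `X` of `N M` and `u ∈ T_p M`. -/
def nablaN (X : M → Ambient n) (p : M) (u : Ambient n) : Ambient n :=
  norProj m φ p (nabla m φ X p u)

/-- The trace with respect to `g` of a bilinear map `Q` on `T_p M`: the sum of `Q(e_i, e_i)` over
an orthonormal basis `(e_i)` of `T_p M`. -/
def traceG (p : M) (Q : Ambient n → Ambient n → Ambient n) : Ambient n :=
  ∑ i, Q (stdOrthonormalBasis ℝ (tangentPlane m φ p) i) (stdOrthonormalBasis ℝ (tangentPlane m φ p) i)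

/-- The second covariant derivative `∇²_{u,v} X = ∇_u ∇_V X - ∇_{∇^T_u V} X` (with `V` a vector
field on `M` that extends `v`), for a connection `D` on a bundle over `M`, where `D X p u` is the
derivative of the section `X` in the direction `u ∈ T_p M`. -/
def secondCovDeriv (D : (M → Ambient n) → M → Ambient n → Ambient n)
    (X : M → Ambient n) (p : M) (u v : Ambient n) : Ambient n :=
  D (fun q => D X q (tanExtend m φ v q)) p u - D X p (nablaT m φ (tanExtend m φ v) p u)

/-- The (nonnegative) Laplacian `- tr ∇²` of a connection `D`. -/
def laplacian (D : (M → Ambient n) → M → Ambient n → Ambient n)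
    (X : M → Ambient n) (p : M) : Ambient n :=
  - traceG m φ p (secondCovDeriv m φ D X p)

/-! ### Harmonicity and biharmonicity of index `k` -/

/-- The covariant derivative `∇ Tφ` of the tangent map, a section of `T^*M ⊗ T^*M ⊗ φ^* T S^n`:
`(∇_u Tφ)(v) = ∇_u (Tφ V) - Tφ (∇^T_u V)`. -/
def nablaTangentMap (p : M) (u v : Ambient n) : Ambient n :=
  nabla m φ (tanExtend m φ v) p u - nablaT m φ (tanExtend m φ v) p u

/-- The divergence `δ Tφ = - tr ∇ Tφ`, a section of `φ^* T S^n`; `φ` is harmonic iff it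
vanishes. -/
def deltaT (p : M) : Ambient n := - traceG m φ p (nablaTangentMap m φ p)

/-- The endomorphism `𝒮(X) = tr R_{X, Tφ} Tφ` of `φ^* T S^n`. -/
def curvatureEnd (p : M) (x : Ambient n) : Ambient n :=
  traceG m φ p (fun u v => sphereCurvature (φ p : Ambient n) x u v)

/-- `M` is biharmonic of index `k` in `S^n`:
`Δ (δ Tφ) - 𝒮(δ Tφ) + k δ Tφ = 0`. -/
def IsBiharmonicOfIndex (k : ℝ) : Prop :=
  ∀ p : M, laplacian m φ (nabla m φ) (deltaT m φ) p - curvatureEnd m φ p (deltaT m φ p)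
    + k • deltaT m φ p = 0

/-! ### Second fundamental form, Weingarten operator, mean curvature -/

/-- The second fundamental form `B(u, v)`: the normal part of `∇_u V`, with `V` a vector field on
`M` that extends `v`. -/
def secondFundamentalForm (p : M) (u v : Ambient n) : Ambient n :=
  norProj m φ p (nabla m φ (tanExtend m φ v) p u)

/-- The Weingarten operator `A_ξ` of `ξ ∈ N_p M`: the element `A_ξ u` of `T_p M` such that
`⟨A_ξ u, v⟩ = ⟨B(u, v), ξ⟩` for all `v ∈ T_p M`. -/
def weingarten (p : M) (ξ u : Ambient n) : Ambient n :=
  ∑ i, inner ℝ (secondFundamentalForm m φ p u (stdOrthonormalBasis ℝ (tangentPlane m φ p) i)) ξ •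
    (stdOrthonormalBasis ℝ (tangentPlane m φ p) i : Ambient n)

/-- The mean curvature `H = (1/m) tr B`. -/
def meanCurvature (p : M) : Ambient n :=
  (1 / (m : ℝ)) • traceG m φ p (secondFundamentalForm m φ p)

end SphereSubmanifold

end

/-! Write `D` for the flat derivative in `ℝ^(n+1)` and `P` for the projection onto the tangent
planes of `M`. Since the trace of `∇Tφ` is `m H`, one has `δTφ = -m H`. The sphere has constant
curvature `1`, so `𝒮` multiplies normal vectors by `m`, and the bitension field is `-m (ΔH - (m - k)
H)`. For `m ≠ 0` it remains to split `ΔH` into its normal and tangential parts; for `m = 0`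
everything vanishes.

Normal part: `∇_e H = ∇^N_e H - A_H e`, and a second derivative adds `-B(e, A_H e)` to `∇^N_e ∇^N_e
H` (`along_along_normal`). The trace gives `Δ^N H + tr B(·, A_H ·)`.

Tangential part: differentiating `⟨D_e H, V⟩ = -⟨H, B(e, V)⟩` yields `-2 ⟨A_{∇^N_e H} e, v⟩ - ⟨H,
(∇_e B)(e, v)⟩` (`inner_along_along_normal`). By Codazzi (`inner_along_along_proj_comm`) the last
term is `⟨H, (∇_v B)(e, e)⟩`, whose trace is `m ⟨H, ∇_v H⟩ = (m/2) d|H|²(v)`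
(`sum_inner_along_along_proj`, `inner_along_meanCurvature`).

All of this is calculus with `dP` in a chart: on tangent vectors `dP(u)` is the Euclidean second
fundamental form, on normal vectors it is the Weingarten operator. Tangent vectors are fixed vectors
of `ℝ^(n+1)`, extended by `P`. Traces that must be differentiated are rewritten in a fixed
orthonormal basis of `ℝ^(n+1)`, because the bases chosen in the tangent planes need not vary
smoothly. -/

noncomputable section

namespace SphereSubmanifold

open scoped RealInnerProductSpace

/-! ### Local calculus of an immersion in a Euclidean space -/

section LocalCalculus

variable {E V W : Type*} [NormedAddCommGroup E] [NormedSpace ℝ E]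
  [NormedAddCommGroup V] [InnerProductSpace ℝ V] [NormedAddCommGroup W] [NormedSpace ℝ W]

/-- The derivative of `X` at `x` in the direction `G x u`. -/
def along (G : E → V →L[ℝ] E) (X : E → W) (x : E) (u : V) : W := fderiv ℝ X x (G x u)

/-- `f` is an immersion of the open set `U` in the unit sphere of `V`, `P x` is the orthogonal
projection onto the range of `fderiv ℝ f x`, and `G x` is `P x` followed by the inverse of
`fderiv ℝ f x`. -/
structure TangentFrame (U : Set E) (f : E → V) (P : E → V →L[ℝ] V) (G : E → V →L[ℝ] E) :
    Prop where
  isOpen : IsOpen U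
  contDiffOn : ContDiffOn ℝ ∞ f U
  contDiffOn_proj : ContDiffOn ℝ ∞ P U
  contDiffOn_inv : ContDiffOn ℝ ∞ G U
  fderiv_apply_inv : ∀ x ∈ U, ∀ u, fderiv ℝ f x (G x u) = P x u
  inv_fderiv : ∀ x ∈ U, ∀ w, G x (fderiv ℝ f x w) = w
  inner_proj : ∀ x ∈ U, ∀ u v, ⟪P x u, v⟫ = ⟪u, P x v⟫
  norm_eq_one : ∀ x ∈ U, ‖f x‖ = 1

section along

variable (G : E → V →L[ℝ] E) {x : E} (u : V)

theorem along_add_right (X : E → W) (x : E) (u v : V) :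
    along G X x (u + v) = along G X x u + along G X x v := by
  simp [along]

theorem along_smul_right (X : E → W) (x : E) (c : ℝ) (u : V) :
    along G X x (c • u) = c • along G X x u := by
  simp [along]

theorem along_zero_right (X : E → W) (x : E) : along G X x 0 = 0 := by simp [along]

theorem along_sub {X Y : E → W} (hX : DifferentiableAt ℝ X x) (hY : DifferentiableAt ℝ Y x) :
    along G (fun y => X y - Y y) x u = along G X x u - along G Y x u := by
  simp [along, fderiv_fun_sub hX hY]

theorem along_const_smul {X : E → W} (hX : DifferentiableAt ℝ X x) (c : ℝ) :
    along G (fun y => c • X y) x u = c • along G X x u := by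
  simp [along, fderiv_fun_const_smul hX]

theorem along_const (c : W) : along G (fun _ : E => c) x u = 0 := by
  simp [along]

theorem along_smul {a : E → ℝ} {X : E → W} (ha : DifferentiableAt ℝ a x)
    (hX : DifferentiableAt ℝ X x) :
    along G (fun y => a y • X y) x u = along G a x u • X x + a x • along G X x u := by
  simp [along, fderiv_fun_smul ha hX, add_comm]

theorem along_sum {ι : Type*} (s : Finset ι) {X : ι → E → W}
    (hX : ∀ i ∈ s, DifferentiableAt ℝ (X i) x) :
    along G (fun y => ∑ i ∈ s, X i y) x u = ∑ i ∈ s, along G (X i) x u := by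
  simp [along, fderiv_fun_sum hX]

theorem along_clm_apply {F : Type*} [NormedAddCommGroup F] [NormedSpace ℝ F]
    {A : E → F →L[ℝ] W} {X : E → F}
    (hA : DifferentiableAt ℝ A x) (hX : DifferentiableAt ℝ X x) :
    along G (fun y => A y (X y)) x u = along G A x u (X x) + A x (along G X x u) := by
  simp [along, fderiv_clm_apply hA hX, add_comm]

theorem along_clm_apply_const {F : Type*} [NormedAddCommGroup F] [NormedSpace ℝ F]
    {A : E → F →L[ℝ] W} (hA : DifferentiableAt ℝ A x) (w : F) :
    along G (fun y => A y w) x u = along G A x u w := by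
  rw [along_clm_apply G u hA (differentiableAt_const w), along_const]; simp

theorem along_inner {X Y : E → V} (hX : DifferentiableAt ℝ X x) (hY : DifferentiableAt ℝ Y x) :
    along G (fun y => ⟪X y, Y y⟫) x u = ⟪X x, along G Y x u⟫ + ⟪along G X x u, Y x⟫ := by
  simp [along, fderiv_inner_apply ℝ hX hY]

theorem along_congr {U : Set E} (hU : IsOpen U) (hx : x ∈ U) {X Y : E → W}
    (h : ∀ y ∈ U, X y = Y y) : along G X x u = along G Y x u := by
  have : X =ᶠ[nhds x] Y := Filter.eventuallyEq_of_mem (hU.mem_nhds hx) h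
  simp [along, this.fderiv_eq]

end along

namespace TangentFrame

variable {U : Set E} {f : E → V} {P : E → V →L[ℝ] V} {G : E → V →L[ℝ] E}
  (h : TangentFrame U f P G) {x : E} (hx : x ∈ U)

include h in
theorem contDiffOn_along {X : E → W} (hX : ContDiffOn ℝ ∞ X U) (u : V) :
    ContDiffOn ℝ ∞ (fun y => along G X y u) U :=
  (hX.fderiv_of_isOpen h.isOpen (by simp)).clm_apply (h.contDiffOn_inv.clm_apply contDiffOn_const)

include h hx in
theorem differentiableAt {X : E → W} (hX : ContDiffOn ℝ ∞ X U) : DifferentiableAt ℝ X x :=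
  (hX.contDiffAt (h.isOpen.mem_nhds hx)).differentiableAt (by simp)

include h hx

theorem along_self (u : V) : along G f x u = P x u := h.fderiv_apply_inv x hx u

theorem inv_proj (u : V) : G x (P x u) = G x u := by
  rw [← h.fderiv_apply_inv x hx, h.inv_fderiv x hx]

theorem along_proj (X : E → W) (u : V) : along G X x (P x u) = along G X x u := by
  rw [along, h.inv_proj hx, along]

theorem proj_proj (u : V) : P x (P x u) = P x u := by
  rw [← h.fderiv_apply_inv x hx, h.inv_proj hx, h.fderiv_apply_inv x hx]

theorem inner_self_eq_one : ⟪f x, f x⟫ = 1 := by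
  rw [real_inner_self_eq_norm_sq, h.norm_eq_one x hx]; norm_num

/-- Differentiate `⟪f, f⟫ = 1`. -/
theorem inner_position_proj (u : V) : ⟪f x, P x u⟫ = 0 := by
  have h1 : along G (fun y => ⟪f y, f y⟫) x u = 0 := by
    rw [along_congr G u h.isOpen hx (fun y hy => h.inner_self_eq_one hy), along_const]
  have hf := h.differentiableAt hx h.contDiffOn
  rw [along_inner G u hf hf, h.along_self hx, real_inner_comm] at h1
  rw [real_inner_comm]
  linarith [real_inner_comm (P x u) (f x)]

theorem proj_position : P x (f x) = 0 := by
  rw [← inner_self_eq_zero (𝕜 := ℝ), h.inner_proj x hx, h.proj_proj hx,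
    h.inner_position_proj hx]

theorem inner_eq_zero_of_proj_eq_zero {u v : V} (hu : P x u = 0) (hv : P x v = v) :
    ⟪u, v⟫ = 0 := by
  rw [← hv, ← h.inner_proj x hx, hu, inner_zero_left]

/-- The derivative of the projection is symmetric. -/
theorem inner_along_proj (e u v : V) : ⟪along G P x e u, v⟫ = ⟪u, along G P x e v⟫ := by
  have hP := h.differentiableAt hx h.contDiffOn_proj
  have h1 := along_congr G e h.isOpen hx (fun y hy => h.inner_proj y hy u v)
  rw [along_inner G e (hP.clm_apply (differentiableAt_const u)) (differentiableAt_const v),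
    along_inner G e (differentiableAt_const u) (hP.clm_apply (differentiableAt_const v)),
    along_clm_apply_const G e hP, along_clm_apply_const G e hP, along_const, along_const] at h1
  simpa using h1

/-- The derivative of the identity `P ∘ P = P`. -/
theorem along_proj_apply_proj (e u : V) :
    along G P x e (P x u) + P x (along G P x e u) = along G P x e u := by
  have hP := h.differentiableAt hx h.contDiffOn_proj
  have h1 := along_congr G e h.isOpen hx (fun y hy => h.proj_proj hy u)
  rw [along_clm_apply G e hP (hP.clm_apply (differentiableAt_const u)),
    along_clm_apply_const G e hP] at h1
  exact h1

/-- From `P ∘ P = P`: `dP(e)` exchanges tangent and normal vectors. On tangent vectors it is the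
second fundamental form in the Euclidean space. -/
theorem proj_along_proj_of_tangent (e : V) {v : V} (hv : P x v = v) :
    P x (along G P x e v) = 0 := by
  have h1 := h.along_proj_apply_proj hx e v
  rw [hv] at h1
  simpa using h1

/-- The other half of the exchange: on normal vectors `dP(e)` is tangent-valued, and is the
Weingarten operator. -/
theorem proj_along_proj_of_normal (e : V) {v : V} (hv : P x v = 0) :
    P x (along G P x e v) = along G P x e v := by
  have h1 := h.along_proj_apply_proj hx e v
  rw [hv] at h1
  simpa using h1

theorem along_along {X : E → W} (hX : ContDiffOn ℝ ∞ X U) (u v : V) :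
    along G (fun y => along G X y v) x u =
      fderiv ℝ (fderiv ℝ X) x (G x u) (G x v) + fderiv ℝ X x (along G G x u v) := by
  have hG := h.differentiableAt hx h.contDiffOn_inv
  have hX' := h.differentiableAt hx (hX.fderiv_of_isOpen h.isOpen (m := ∞) (by simp))
  have := along_clm_apply G u hX' (hG.clm_apply (differentiableAt_const v))
  rw [along_clm_apply_const G u hG] at this
  exact this

/-- The Hessian of `X` is symmetric, so only the bracket of the fields `y ↦ G y u` and `y ↦ G y v`
survives. -/
theorem along_along_sub {X : E → W} (hX : ContDiffOn ℝ ∞ X U) (u v : V) :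
    along G (fun y => along G X y v) x u - along G (fun y => along G X y u) x v =
      fderiv ℝ X x (along G G x u v - along G G x v u) := by
  have hs : IsSymmSndFDerivAt ℝ X x :=
    (hX.contDiffAt (h.isOpen.mem_nhds hx)).isSymmSndFDerivAt
      (by simpa using (WithTop.coe_le_coe.2 le_top : ((2 : ℕ∞) : WithTop ℕ∞) ≤ ((⊤ : ℕ∞) : WithTop ℕ∞)))
  rw [h.along_along hx hX, h.along_along hx hX, hs.eq, map_sub]
  abel

theorem along_proj_sub (u v : V) :
    along G P x u v - along G P x v u = fderiv ℝ f x (along G G x u v - along G G x v u) := by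
  have hP := h.differentiableAt hx h.contDiffOn_proj
  rw [← h.along_along_sub hx h.contDiffOn,
    along_congr G u h.isOpen hx (fun y hy => h.along_self hy v),
    along_congr G v h.isOpen hx (fun y hy => h.along_self hy u),
    along_clm_apply_const G u hP, along_clm_apply_const G v hP]

/-- The second fundamental form is symmetric. -/
theorem along_proj_comm {u v : V} (hu : P x u = u) (hv : P x v = v) :
    along G P x u v = along G P x v u := by
  rw [← sub_eq_zero]
  -- The difference is `df` of a bracket, hence tangent; each of its two terms is normal, so it
  -- vanishes.
  have h2 : P x (along G P x u v - along G P x v u) =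
      along G P x u v - along G P x v u := by
    rw [h.along_proj_sub hx, ← h.fderiv_apply_inv x hx, h.inv_fderiv x hx]
  rw [← h2, map_sub, h.proj_along_proj_of_tangent hx u hv, h.proj_along_proj_of_tangent hx v hu,
    sub_zero]

/-- With `P` inserted the symmetry holds for all `u`, `v` at every point of `U`, so it can be
differentiated to give Codazzi. -/
theorem along_proj_comm' (u v : V) :
    along G P x u (P x v) = along G P x v (P x u) := by
  rw [← h.along_proj hx P u, ← h.along_proj hx P v]
  exact h.along_proj_comm hx (h.proj_proj hx u) (h.proj_proj hx v)

/-- Derivatives in the directions of the projections of two tangent vectors commute. -/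
theorem along_comm {X : E → W} (hX : ContDiffOn ℝ ∞ X U) {u v : V} (hu : P x u = u)
    (hv : P x v = v) :
    along G (fun y => along G X y v) x u = along G (fun y => along G X y u) x v := by
  rw [← sub_eq_zero, h.along_along_sub hx hX]
  have h2 := h.along_proj_sub hx u v
  rw [h.along_proj_comm hx hu hv, sub_self] at h2
  -- The image of the bracket under `df` is zero, and `G` is a left inverse of `df`.
  rw [← h.inv_fderiv x hx (along G G x u v - along G G x v u), ← h2]
  simp

end TangentFrame

end LocalCalculus

/-! ### Curvature of the sphere -/

section Curvature

variable {n : ℕ} {q : Ambient n}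

theorem sphereProj_eq (q x : Ambient n) : sphereProj q x = x - (⟪q, x⟫ / ‖q‖ ^ 2) • q := by
  rw [sphereProj, Submodule.starProjection_orthogonal_val, Submodule.starProjection_singleton]
  simp

theorem sphereProj_unit (hq : ‖q‖ = 1) (x : Ambient n) : sphereProj q x = x - ⟪q, x⟫ • q := by
  rw [sphereProj_eq, hq]; simp

theorem sphereProj_self (q : Ambient n) : sphereProj q q = 0 := by
  rw [sphereProj, Submodule.starProjection_orthogonal_val,
    Submodule.starProjection_eq_self_iff.2 (Submodule.mem_span_singleton_self q), sub_self]

theorem sphereProj_add (q x y : Ambient n) :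
    sphereProj q (x + y) = sphereProj q x + sphereProj q y := map_add _ _ _

theorem sphereProj_sub (q x y : Ambient n) :
    sphereProj q (x - y) = sphereProj q x - sphereProj q y := map_sub _ _ _

theorem sphereProj_neg (q x : Ambient n) : sphereProj q (-x) = -sphereProj q x := map_neg _ _

theorem sphereProj_smul (q x : Ambient n) (c : ℝ) :
    sphereProj q (c • x) = c • sphereProj q x := map_smul _ _ _

theorem sphereProj_sphereProj (q x : Ambient n) :
    sphereProj q (sphereProj q x) = sphereProj q x := by
  rw [sphereProj_eq q x, sphereProj_sub, sphereProj_smul, sphereProj_self, smul_zero, sub_zero,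
    sphereProj_eq]

theorem differentiableAt_inner_div {r : Ambient n} (hr : r ≠ 0) (z : Ambient n) :
    DifferentiableAt ℝ (fun s : Ambient n => ⟪s, z⟫ / ‖s‖ ^ 2) r := by
  have h0 : ‖r‖ ^ 2 ≠ 0 := by simpa using hr
  have h1 : DifferentiableAt ℝ (fun s : Ambient n => ⟪s, z⟫) r :=
    differentiableAt_fun_id.inner ℝ (differentiableAt_const z)
  have h2 : DifferentiableAt ℝ (fun s : Ambient n => ‖s‖ ^ 2) r :=
    differentiableAt_fun_id.norm_sq ℝ
  simp only [div_eq_mul_inv]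
  exact h1.fun_mul (h2.fun_inv h0)

theorem sphereProj_eq_fun (z : Ambient n) :
    (fun r : Ambient n => sphereProj r z) = fun r => z - (⟪r, z⟫ / ‖r‖ ^ 2) • r :=
  funext fun r => sphereProj_eq r z

theorem differentiableAt_sphereProj {r : Ambient n} (hr : r ≠ 0) (z : Ambient n) :
    DifferentiableAt ℝ (fun s : Ambient n => sphereProj s z) r := by
  rw [sphereProj_eq_fun]
  exact (differentiableAt_const z).sub ((differentiableAt_inner_div hr z).fun_smul differentiableAt_fun_id)

/-- Differentiating the coefficient of `r` gives a multiple of `r`, which the projection kills. It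
is needed off the sphere as well, since the result is differentiated again in the ambient space. -/
theorem sphereProj_fderiv_sphereProj {r : Ambient n} (hr : r ≠ 0) (z w : Ambient n) :
    sphereProj r (fderiv ℝ (fun s : Ambient n => sphereProj s z) r w) =
      -((⟪r, z⟫ / ‖r‖ ^ 2) • sphereProj r w) := by
  rw [sphereProj_eq_fun, fderiv_fun_sub (differentiableAt_const z)
    ((differentiableAt_inner_div hr z).fun_smul differentiableAt_fun_id),
    fderiv_fun_smul (differentiableAt_inner_div hr z) differentiableAt_fun_id]
  simp [sphereProj_neg, sphereProj_add, sphereProj_smul, sphereProj_self]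

theorem sphereNabla_sphereProj {r : Ambient n} (hr : r ≠ 0) (y z : Ambient n) :
    sphereNabla (fun s => sphereProj s y) (fun s => sphereProj s z) r =
      -((⟪r, z⟫ / ‖r‖ ^ 2) • sphereProj r y) := by
  rw [sphereNabla, sphereProj_fderiv_sphereProj hr, sphereProj_sphereProj]

theorem fderiv_inner_div (hq : ‖q‖ = 1) {z : Ambient n} (hz : ⟪q, z⟫ = 0) (w : Ambient n) :
    fderiv ℝ (fun s : Ambient n => ⟪s, z⟫ / ‖s‖ ^ 2) q w = ⟪w, z⟫ := by
  have hne : ‖q‖ ^ 2 ≠ 0 := by simp [hq]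
  have h1 : DifferentiableAt ℝ (fun s : Ambient n => ⟪s, z⟫) q :=
    differentiableAt_fun_id.inner ℝ (differentiableAt_const z)
  have h2 : DifferentiableAt ℝ (fun s : Ambient n => ‖s‖ ^ 2) q :=
    differentiableAt_fun_id.norm_sq ℝ
  have h3 : fderiv ℝ (fun s : Ambient n => ⟪s, z⟫) q w = ⟪w, z⟫ := by
    have := fderiv_inner_apply ℝ (differentiableAt_fun_id (𝕜 := ℝ) (x := q))
      (differentiableAt_const z) w
    simpa using this
  simp only [div_eq_mul_inv]
  rw [fderiv_fun_mul h1 (h2.fun_inv hne)]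
  simp [hz, hq, h3]

/-- The coefficient `⟪r, z⟫ / ‖r‖ ^ 2` vanishes at `q`, so only its own derivative contributes. -/
theorem sphereNabla_sphereNabla (hq : ‖q‖ = 1) {x y z : Ambient n} (hx : ⟪q, x⟫ = 0)
    (hy : ⟪q, y⟫ = 0) (hz : ⟪q, z⟫ = 0) :
    sphereNabla (fun s => sphereProj s x)
      (sphereNabla (fun s => sphereProj s y) (fun s => sphereProj s z)) q = -(⟪x, z⟫ • y) := by
  have hq0 : q ≠ 0 := by rintro rfl; simp at hq
  have hev : sphereNabla (fun s => sphereProj s y) (fun s => sphereProj s z) =ᶠ[nhds q]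
      fun r => -((⟪r, z⟫ / ‖r‖ ^ 2) • sphereProj r y) := by
    filter_upwards [isOpen_ne.mem_nhds hq0] with r hr using sphereNabla_sphereProj hr y z
  have hpx : sphereProj q x = x := by rw [sphereProj_eq, hx]; simp
  have hpy : sphereProj q y = y := by rw [sphereProj_eq, hy]; simp
  rw [sphereNabla, hev.fderiv_eq, fderiv_fun_neg, fderiv_fun_smul (differentiableAt_inner_div hq0 z)
    (differentiableAt_sphereProj hq0 y)]
  simp only [neg_apply, ContinuousLinearMap.smulRight_apply, hpx, hz, zero_div,
    zero_smul, zero_add, fderiv_inner_div hq hz, sphereProj_neg, sphereProj_smul,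
    hpy]

/-- Constant curvature `1`. The bracket term drops out because the projected extension of `z` is
parallel at `q`. -/
theorem sphereCurvature_eq (hq : ‖q‖ = 1) {x y z : Ambient n} (hx : ⟪q, x⟫ = 0)
    (hy : ⟪q, y⟫ = 0) (hz : ⟪q, z⟫ = 0) :
    sphereCurvature q x y z = ⟪y, z⟫ • x - ⟪x, z⟫ • y := by
  have hq0 : q ≠ 0 := by rintro rfl; simp at hq
  rw [sphereCurvature]
  rw [sphereNabla_sphereNabla hq hx hy hz, sphereNabla_sphereNabla hq hy hx hz, sphereNabla,
    sphereProj_fderiv_sphereProj hq0, hz, zero_div, zero_smul, neg_zero, sub_zero]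
  abel

end Curvature

/-! ### The rough Laplacian of a multiple of the mean curvature, in local form -/

namespace TangentFrame

variable {E V : Type*} [NormedAddCommGroup E] [NormedSpace ℝ E]
  [NormedAddCommGroup V] [InnerProductSpace ℝ V]
  {U : Set E} {f : E → V} {P : E → V →L[ℝ] V} {G : E → V →L[ℝ] E}
  (h : TangentFrame U f P G) {x : E} (hx : x ∈ U)
  {X : E → V} (hX : ContDiffOn ℝ ∞ X U) (hP : ∀ y ∈ U, P y (X y) = 0)
  (hf : ∀ y ∈ U, ⟪f y, X y⟫ = 0)

include h hx hX

include hP in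
-- Weingarten's formula, from differentiating `P X = 0`.
theorem proj_along_normal (u : V) : P x (along G X x u) = -along G P x u (X x) := by
  have h1 := along_congr G u h.isOpen hx hP
  rw [along_const, along_clm_apply G u (h.differentiableAt hx h.contDiffOn_proj)
    (h.differentiableAt hx hX)] at h1
  exact (neg_eq_of_add_eq_zero_right h1).symm

include hP hf in
-- Differentiate `⟪f, X⟫ = 0`; the term `⟪df(u), X⟫` vanishes as `X` is normal. Hence `∇_u X` is the
-- flat derivative, with no correction from the sphere.
theorem inner_position_along_normal (u : V) : ⟪f x, along G X x u⟫ = 0 := by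
  have h1 := along_congr G u h.isOpen hx hf
  rw [along_const, along_inner G u (h.differentiableAt hx h.contDiffOn)
    (h.differentiableAt hx hX), h.along_self hx, h.inner_proj x hx, hP x hx, inner_zero_right,
    add_zero] at h1
  exact h1

include hP in
/-- The normal part of the second derivative of a normal field. -/
theorem along_along_normal (e : V) :
    along G (fun y => along G X y e) x e - P x (along G (fun y => along G X y e) x e) =
      along G (fun y => along G X y e - P y (along G X y e)) x e
        - P x (along G (fun y => along G X y e - P y (along G X y e)) x e)
        - along G P x e (along G P x e (X x)) := by
  have hd := h.differentiableAt hx (h.contDiffOn_along hX e)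
  have hPd := h.differentiableAt hx h.contDiffOn_proj
  rw [along_sub G e hd (hPd.clm_apply hd), along_clm_apply G e hPd hd]
  -- This isolates the normal part of `dP(e)(D_e X)` as `-dP(e)(dP(e) X)`, the term that becomes
  -- `-B(e, A_X e)`.
  have h2 := h.along_proj_apply_proj hx e (along G X x e)
  rw [h.proj_along_normal hx hX hP] at h2
  have h3 : P x (along G P x e (along G X x e)) =
      along G P x e (along G X x e) + along G P x e (along G P x e (X x)) := by
    rw [map_neg] at h2
    rw [← sub_eq_zero]
    rw [← sub_eq_zero] at h2
    rw [← h2]; abel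
  simp only [map_sub, map_add, h.proj_proj hx, h3]
  abel

include hP in
/-- The tangential part of the second derivative of a normal field. -/
theorem inner_along_along_normal (e : V) {v : V} (hv : P x v = v) :
    ⟪along G (fun y => along G X y e) x e, v⟫ =
      -2 * ⟪along G X x e, along G P x e v⟫
        - ⟪X x, along G (fun y => along G P y e) x e v⟫ := by
  have hd := h.differentiableAt hx (h.contDiffOn_along hX e)
  have hXd := h.differentiableAt hx hX
  have hPd := h.differentiableAt hx h.contDiffOn_proj
  have hPdd := h.differentiableAt hx (h.contDiffOn_along h.contDiffOn_proj e)
  -- The identity to differentiate along `e`: each side contributes one copy of `⟪D_e X, dP(e) v⟫`,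
  -- whence the factor `-2`.
  have h1 : ∀ y ∈ U, ⟪along G X y e, P y v⟫ = -1 * ⟪X y, along G P y e v⟫ := by
    intro y hy
    rw [← h.inner_proj y hy, h.proj_along_normal hy hX hP, inner_neg_left,
      h.inner_along_proj hy]
    ring
  have h2 := along_congr G e h.isOpen hx h1
  have h3 := along_const_smul G e
    (hXd.inner ℝ (hPdd.clm_apply (differentiableAt_const v))) (-1)
  simp only [smul_eq_mul] at h3
  rw [h3, along_inner G e hXd (hPdd.clm_apply (differentiableAt_const v)),
    along_inner G e hd (hPd.clm_apply (differentiableAt_const v)),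
    along_clm_apply_const G e hPd, along_clm_apply_const G e hPdd, hv] at h2
  linarith

omit hX in
/-- The Codazzi equation, paired with a normal vector `w`. -/
theorem inner_along_along_proj_comm {w e v : V} (hw : P x w = 0) (he : P x e = e)
    (hv : P x v = v) :
    ⟪w, along G (fun y => along G P y e) x e v⟫ = ⟪w, along G (fun y => along G P y e) x v e⟫ := by
  have hPd := h.differentiableAt hx h.contDiffOn_proj
  have hPdd := fun u => h.differentiableAt hx (h.contDiffOn_along h.contDiffOn_proj u)
  have h1 := along_congr G e h.isOpen hx (fun y hy => h.along_proj_comm' hy e v)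
  rw [along_clm_apply G e (hPdd e) (hPd.clm_apply (differentiableAt_const v)),
    along_clm_apply G e (hPdd v) (hPd.clm_apply (differentiableAt_const e)),
    along_clm_apply_const G e hPd, along_clm_apply_const G e hPd, hv, he] at h1
  -- The cross terms of the product rule are tangent, because `dP` is applied twice to a tangent
  -- vector; `w` does not see them.
  have h2 : ∀ a b c : V, P x c = c → ⟪w, along G P x a (along G P x b c)⟫ = 0 := by
    intro a b c hc
    rw [← h.proj_along_proj_of_normal hx a (h.proj_along_proj_of_tangent hx b hc),
      ← h.inner_proj x hx, hw, inner_zero_left]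
  have h3 := congrArg (fun z => ⟪w, z⟫) h1
  simp only [inner_add_right, h2 _ _ _ hv, h2 _ _ _ he, add_zero] at h3
  rw [h3, h.along_comm hx h.contDiffOn_proj he hv]

end TangentFrame

/-! ### Traces -/

section Trace

variable {V W : Type*} [NormedAddCommGroup V] [InnerProductSpace ℝ V]
  [AddCommGroup W] [Module ℝ W] {ι κ : Type*} [Fintype ι] [Fintype κ]

/-- The trace of a bilinear map over a subspace, in terms of an orthonormal basis of the whole
space. -/
theorem sum_bilinear_orthonormalBasis (K : Submodule ℝ V) [K.HasOrthogonalProjection]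
    (b : OrthonormalBasis ι ℝ K) (c : OrthonormalBasis κ ℝ V) (β : V →ₗ[ℝ] V →ₗ[ℝ] W) :
    ∑ i, β (b i) (b i) = ∑ a, β (K.starProjection (c a)) (c a) := by
  have h1 : ∀ a, K.starProjection (c a) = ∑ i, ⟪(b i : V), c a⟫ • (b i : V) := by
    intro a
    rw [Submodule.starProjection_apply, b.orthogonalProjectionOnto_apply_eq_sum]
    simp
  have h2 : ∀ i, β (b i) (b i) = ∑ a, ⟪(b i : V), c a⟫ • β (b i) (c a) := by
    intro i
    have := congrArg (β (b i)) (c.sum_repr' (b i : V))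
    rw [map_sum] at this
    simpa [real_inner_comm] using this.symm
  simp only [h1, h2, map_sum, map_smul, LinearMap.sum_apply, LinearMap.smul_apply]
  exact Finset.sum_comm

end Trace

/-! ### Trace of the second fundamental form and its derivative -/

namespace TangentFrame

variable {E V : Type*} [NormedAddCommGroup E] [NormedSpace ℝ E]
  [NormedAddCommGroup V] [InnerProductSpace ℝ V]
  {U : Set E} {f : E → V} {P : E → V →L[ℝ] V} {G : E → V →L[ℝ] E}
  {κ : Type*} [Fintype κ]

/-- The trace of the second fundamental form in the Euclidean space, computed in a fixed
orthonormal basis `c` of that space. -/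
def euclideanTension (P : E → V →L[ℝ] V) (G : E → V →L[ℝ] E) (c : OrthonormalBasis κ ℝ V)
    (x : E) : V := ∑ a, along G P x (c a) (c a)

variable (h : TangentFrame U f P G) {x : E} (hx : x ∈ U) (c : OrthonormalBasis κ ℝ V)

include h in
theorem contDiffOn_euclideanTension : ContDiffOn ℝ ∞ (euclideanTension P G c) U :=
  ContDiffOn.sum fun a _ => (h.contDiffOn_along h.contDiffOn_proj (c a)).clm_apply contDiffOn_const

variable {ι : Type*} [Fintype ι] {K : Submodule ℝ V} [K.HasOrthogonalProjection]
  (b : OrthonormalBasis ι ℝ K) (hK : ∀ u, K.starProjection u = P x u)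

include h hx hK

omit h hx [NormedAddCommGroup E] [NormedSpace ℝ E] in
theorem proj_basis (i : ι) : P x (b i) = b i := by
  rw [← hK, Submodule.starProjection_eq_self_iff]; exact (b i).2

/-- Passing to the basis `c` puts a `P` in one slot, and `dP(P u) = dP(u)` removes it. -/
theorem sum_along_proj : ∑ i, along G P x (b i) (b i) = euclideanTension P G c x := by
  let β : V →ₗ[ℝ] V →ₗ[ℝ] V :=
    LinearMap.mk₂ ℝ (fun u v => along G P x u v) (by simp [along_add_right])
      (by simp [along_smul_right]) (by simp) (by simp)
  have h1 := sum_bilinear_orthonormalBasis K b c β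
  simp only [β, LinearMap.mk₂_apply, hK, h.along_proj hx] at h1
  exact h1

include b in
theorem proj_euclideanTension : P x (euclideanTension P G c x) = 0 := by
  rw [← h.sum_along_proj hx c b hK, map_sum]
  exact Finset.sum_eq_zero fun i _ =>
    h.proj_along_proj_of_tangent hx _ (proj_basis b hK i)

omit hK in
theorem inner_along_proj_normal {w n : V} (hw : P x w = 0) (hn : P x n = 0) (u : V) :
    ⟪w, along G P x u n⟫ = 0 := by
  rw [← h.proj_along_proj_of_normal hx u hn, ← h.inner_proj x hx, hw, inner_zero_left]

/-- Trace and derivative commute against a normal vector. Freezing the vectors `P x (c a)` while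
differentiating costs terms `dP(dP(v) c_a) c_a`, and their sum is invisible to `w`. -/
theorem sum_inner_along_along_proj {w : V} (hw : P x w = 0) (v : V) :
    ∑ i, ⟪w, along G (fun y => along G P y (b i)) x v (b i)⟫ =
      ⟪w, along G (euclideanTension P G c) x v⟫ := by
  have hPd := h.differentiableAt hx h.contDiffOn_proj
  have hPs := fun u => h.contDiffOn_along h.contDiffOn_proj u
  have hPdd := fun u => h.differentiableAt hx (hPs u)
  have hadd : ∀ u u', along G (fun y => along G P y (u + u')) x v =
      along G (fun y => along G P y u) x v + along G (fun y => along G P y u') x v := by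
    intro u u'
    rw [along_congr G v h.isOpen hx (fun y _ => along_add_right G P y u u')]
    have := fderiv_fun_add (hPdd u) (hPdd u')
    rw [along, this, add_apply, along, along]
  have hsmul : ∀ (r : ℝ) u, along G (fun y => along G P y (r • u)) x v =
      r • along G (fun y => along G P y u) x v := by
    intro r u
    rw [along_congr G v h.isOpen hx (fun y _ => along_smul_right G P y r u),
      along_const_smul G v (hPdd u)]
  let β : V →ₗ[ℝ] V →ₗ[ℝ] ℝ :=
    LinearMap.mk₂ ℝ (fun u z => ⟪w, along G (fun y => along G P y u) x v z⟫)
      (by simp [hadd, inner_add_right]) (by simp [hsmul, inner_smul_right])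
      (by simp [inner_add_right]) (by simp [inner_smul_right])
  let γ : V →ₗ[ℝ] V →ₗ[ℝ] ℝ :=
    LinearMap.mk₂ ℝ (fun z u => ⟪w, along G P x (along G P x v u) z⟫)
      (by simp [inner_add_right]) (by simp [inner_smul_right])
      (by simp [along_add_right, inner_add_right]) (by simp [along_smul_right, inner_smul_right])
  have hβ := sum_bilinear_orthonormalBasis K b c β
  have hγ := sum_bilinear_orthonormalBasis K b c γ
  simp only [β, γ, LinearMap.mk₂_apply, hK] at hβ hγ
  rw [hβ]
  -- For tangent `b i` the vector `dP(v) (b i)` is normal, and derivatives in normal directions are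
  -- zero.
  have h0 : ∑ i, ⟪w, along G P x (along G P x v (b i)) (b i)⟫ = 0 :=
    Finset.sum_eq_zero fun i _ => by
      rw [← h.along_proj hx, h.proj_along_proj_of_tangent hx _ (proj_basis b hK i),
        along_zero_right]
      simp
  rw [h0] at hγ
  have h1 : ∀ z u : V, ⟪w, along G P x u (P x z)⟫ = ⟪w, along G P x u z⟫ := by
    intro z u
    have := h.inner_along_proj_normal hx hw (n := z - P x z)
      (by rw [map_sub, h.proj_proj hx, sub_self]) u
    rw [map_sub, inner_sub_right] at this
    linarith
  simp only [h1] at hγ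
  -- Differentiate `dP(u) = dP(P u)` with the inner `P` allowed to vary.
  have h2 : ∀ u, along G (fun y => along G P y u) x v =
      along G (fun y => along G P y (P x u)) x v + along G P x (along G P x v u) := by
    intro u
    have hP2 := h.contDiffOn_proj.fderiv_of_isOpen h.isOpen (m := ∞) (by simp)
    have hG := h.differentiableAt hx h.contDiffOn_inv
    have hS := h.differentiableAt hx (hP2.clm_comp h.contDiffOn_inv)
    have hA : ∀ z, along G (fun y => along G P y z) x v =
        along G (fun y => (fderiv ℝ P y).comp (G y)) x v z := fun z =>
      along_clm_apply_const G v hS z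
    have h3 := along_congr G v h.isOpen hx (fun y hy => (h.along_proj hy P u).symm)
    rw [h3, hA (P x u)]
    have h4 := along_clm_apply G v hS (hPd.clm_apply (differentiableAt_const u))
    rw [along_clm_apply_const G v hPd] at h4
    exact h4
  have h5 : along G (euclideanTension P G c) x v =
      ∑ a, along G (fun y => along G P y (c a)) x v (c a) := by
    have := along_sum G v Finset.univ (X := fun a y => along G P y (c a) (c a)) (x := x)
      (fun a _ => (hPdd (c a)).clm_apply (differentiableAt_const _))
    simp only [along_clm_apply_const G v (hPdd _)] at this
    exact this
  rw [h5, inner_sum, ← sub_eq_zero, ← Finset.sum_sub_distrib]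
  rw [← neg_eq_zero, ← Finset.sum_neg_distrib, ← hγ.symm]
  refine Finset.sum_congr rfl fun a _ => ?_
  rw [h2 (c a)]
  simp only [add_apply, inner_add_right]
  ring

omit hK in
/-- For a multiple `X` of the trace of the second fundamental form in the sphere, the derivatives
of `X` and of the trace in the Euclidean space agree, up to the factor, when paired with `X`. -/
theorem inner_along_meanCurvature {X : E → V} {r : ℝ}
    (hX : ∀ y ∈ U, X y = r • (euclideanTension P G c y - ⟪f y, euclideanTension P G c y⟫ • f y))
    (hP : P x (X x) = 0) (hf : ⟪f x, X x⟫ = 0) (v : V) :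
    ⟪X x, along G X x v⟫ = r * ⟪X x, along G (euclideanTension P G c) x v⟫ := by
  have hT := h.differentiableAt hx (h.contDiffOn_euclideanTension c)
  have hfd := h.differentiableAt hx h.contDiffOn
  rw [along_congr G v h.isOpen hx hX, along_const_smul G v
    (hT.fun_sub ((hfd.inner ℝ hT).fun_smul hfd)),
    along_sub G v hT ((hfd.inner ℝ hT).fun_smul hfd),
    along_smul G v (hfd.inner ℝ hT) hfd, h.along_self hx, inner_smul_right, inner_sub_right,
    inner_add_right, inner_smul_right, inner_smul_right, ← h.inner_proj x hx, hP,
    real_inner_comm (f x) (X x), hf]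
  simp

end TangentFrame

/-! ### The left inverse of an injective linear map given by the normal equations -/

section NormalEquations

variable {E V : Type*} [NormedAddCommGroup E] [InnerProductSpace ℝ E] [FiniteDimensional ℝ E]
  [NormedAddCommGroup V] [InnerProductSpace ℝ V] [CompleteSpace E] [CompleteSpace V]

/-- The map `(L† L)⁻¹ L†`. -/
def pseudoInverse (L : E →L[ℝ] V) : V →L[ℝ] E :=
  ((L.adjoint ∘L L).inverse) ∘L L.adjoint

theorem isInvertible_adjoint_comp {L : E →L[ℝ] V} (hL : Function.Injective L) :
    (L.adjoint ∘L L).IsInvertible := by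
  have hinj : Function.Injective (L.adjoint ∘L L) := by
    rw [injective_iff_map_eq_zero]
    intro w hw
    have h1 : ⟪L w, L w⟫ = 0 := by
      rw [← ContinuousLinearMap.adjoint_inner_left]
      have : L.adjoint (L w) = 0 := hw
      rw [this, inner_zero_left]
    exact (injective_iff_map_eq_zero L).1 hL w (inner_self_eq_zero.1 h1)
  exact ⟨(LinearEquiv.ofInjectiveEndo (L.adjoint ∘L L).toLinearMap hinj).toContinuousLinearEquiv,
    by ext; rfl⟩

theorem pseudoInverse_apply_apply {L : E →L[ℝ] V} (hL : Function.Injective L) (w : E) :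
    pseudoInverse L (L w) = w := by
  obtain ⟨e, he⟩ := isInvertible_adjoint_comp hL
  have h1 : L.adjoint (L w) = e w := by rw [← ContinuousLinearMap.comp_apply, ← he]; rfl
  rw [pseudoInverse, ContinuousLinearMap.comp_apply, ← he, h1,
    ContinuousLinearMap.inverse_equiv]
  simp

/-- The normal equations `L† L L⁺ = L†` give `⟪L L⁺ u, v⟫ = ⟪L L⁺ u, L L⁺ v⟫`, which is symmetric in
`u` and `v`. -/
theorem inner_apply_pseudoInverse {L : E →L[ℝ] V} (hL : Function.Injective L) (u v : V) :
    ⟪L (pseudoInverse L u), v⟫ = ⟪u, L (pseudoInverse L v)⟫ := by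
  have key : ∀ u, L.adjoint (L (pseudoInverse L u)) = L.adjoint u := by
    intro u
    obtain ⟨e, he⟩ := isInvertible_adjoint_comp hL
    have h1 : ∀ w, L.adjoint (L w) = e w := by
      intro w; rw [← ContinuousLinearMap.comp_apply, ← he]; rfl
    rw [h1, pseudoInverse, ContinuousLinearMap.comp_apply, ← he, ContinuousLinearMap.inverse_equiv]
    simp
  have h2 : ∀ u v, ⟪L (pseudoInverse L u), v⟫ = ⟪L (pseudoInverse L u), L (pseudoInverse L v)⟫ := by
    intro u v
    rw [← ContinuousLinearMap.adjoint_inner_right, ← key, ContinuousLinearMap.adjoint_inner_right]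
  rw [h2, real_inner_comm, ← h2, real_inner_comm]

omit [FiniteDimensional ℝ E] in
theorem contDiff_adjoint : ContDiff ℝ ∞ (fun L : E →L[ℝ] V => L.adjoint) := by
  have : IsBoundedLinearMap ℝ (fun L : E →L[ℝ] V => L.adjoint) :=
    { map_add := fun A B => map_add _ A B
      map_smul := fun c A => by simp
      bound := ⟨1, one_pos, fun A => by simp⟩ }
  exact this.contDiff

/-- Inversion is smooth at invertible operators; this makes the projection and the lift smooth in a
chart. -/
theorem contDiffAt_pseudoInverse {L : E →L[ℝ] V} (hL : Function.Injective L) :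
    ContDiffAt ℝ ∞ pseudoInverse L := by
  obtain ⟨e, he⟩ := isInvertible_adjoint_comp hL
  have h1 : ContDiffAt ℝ ∞ (fun A : E →L[ℝ] V => A.adjoint ∘L A) L :=
    (contDiff_adjoint.clm_comp contDiff_id).contDiffAt
  have h2 : ContDiffAt ℝ ∞ (ContinuousLinearMap.inverse (R := ℝ) (M := E) (M₂ := E))
      (L.adjoint ∘L L) := he ▸ contDiffAt_map_inverse e
  exact (ContDiffAt.comp (f := fun A : E →L[ℝ] V => A.adjoint ∘L A) L h2 h1).clm_comp contDiff_adjoint.contDiffAt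

end NormalEquations

/-! ### Charts of an immersed submanifold -/

section Chart

variable {m n : ℕ} {M : Type*} [TopologicalSpace M] [ChartedSpace (EuclideanSpace ℝ (Fin m)) M]
  [IsManifold (𝓡 m) ∞ M] {φ : M → UnitSphere n}

variable (φ) in
/-- The immersion in `ℝ^(n+1)`, read in the chart at `p`. -/
def inChart (p : M) (x : EuclideanSpace ℝ (Fin m)) : Ambient n :=
  (φ ((extChartAt (𝓡 m) p).symm x) : Ambient n)

variable (φ) in
/-- `pseudoInverse` of the derivative of `inChart φ p`. -/
def chartInv (p : M) (x : EuclideanSpace ℝ (Fin m)) : Ambient n →L[ℝ] EuclideanSpace ℝ (Fin m) :=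
  pseudoInverse (fderiv ℝ (inChart φ p) x)

variable (φ) in
/-- The projection onto the tangent plane, read in the chart at `p`. -/
def chartProj (p : M) (x : EuclideanSpace ℝ (Fin m)) : Ambient n →L[ℝ] Ambient n :=
  fderiv ℝ (inChart φ p) x ∘L chartInv φ p x

theorem contMDiff_coe_unitSphere :
    ContMDiff (𝓡 n) 𝓘(ℝ, Ambient n) ∞ ((↑) : UnitSphere n → Ambient n) :=
  haveI := Fact.mk (@finrank_euclideanSpace_fin ℝ _ (n + 1))
  contMDiff_coe_sphere

theorem mvfderiv_coe_unitSphere_injective (q : UnitSphere n) :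
    Function.Injective (mvfderiv (𝓡 n) ((↑) : UnitSphere n → Ambient n) q) :=
  haveI := Fact.mk (@finrank_euclideanSpace_fin ℝ _ (n + 1))
  injective_mvfderiv_subtypeVal_sphere q

omit [IsManifold (𝓡 m) ∞ M] in
theorem contMDiff_coe (hφ : IsImmersedSubmanifold m φ) :
    ContMDiff (𝓡 m) 𝓘(ℝ, Ambient n) ∞ (fun q => (φ q : Ambient n)) :=
  contMDiff_coe_unitSphere.comp hφ.contMDiff

omit [IsManifold (𝓡 m) ∞ M] in
theorem tangentMapAt_injective (hφ : IsImmersedSubmanifold m φ) (q : M) :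
    Function.Injective (tangentMapAt m φ q) := by
  have h1 := hφ.contMDiff.mdifferentiableAt (x := q) (by simp)
  have h2 := (contMDiff_coe_unitSphere (n := n)).mdifferentiableAt (x := φ q) (by simp)
  have h3 : ∀ v, tangentMapAt m φ q v =
      mvfderiv (𝓡 n) ((↑) : UnitSphere n → Ambient n) (φ q)
        (mfderiv (𝓡 m) (𝓡 n) φ q v) := fun v => mfderiv_comp_apply q h2 h1 v
  intro v w hvw
  rw [h3, h3] at hvw
  exact hφ.injective_mfderiv q (mvfderiv_coe_unitSphere_injective (φ q) hvw)

variable (p : M) {x : EuclideanSpace ℝ (Fin m)}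

omit [IsManifold (𝓡 m) ∞ M] in
theorem isOpen_target : IsOpen (extChartAt (𝓡 m) p).target := isOpen_extChartAt_target p

theorem contDiffOn_inChart (hφ : IsImmersedSubmanifold m φ) :
    ContDiffOn ℝ ∞ (inChart φ p) (extChartAt (𝓡 m) p).target :=
  contMDiffOn_iff_contDiffOn.1
    ((contMDiff_coe hφ).comp_contMDiffOn (contMDiffOn_extChartAt_symm p))

omit [IsManifold (𝓡 m) ∞ M] in
theorem eventuallyEq_comp_extChartAt {W : Type*} {X : M → W} {Y : EuclideanSpace ℝ (Fin m) → W}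
    (hXY : ∀ y ∈ (extChartAt (𝓡 m) p).target, X ((extChartAt (𝓡 m) p).symm y) = Y y) {q : M}
    (hq : q ∈ (extChartAt (𝓡 m) p).source) : X =ᶠ[nhds q] Y ∘ extChartAt (𝓡 m) p := by
  filter_upwards [(isOpen_extChartAt_source p).mem_nhds hq] with r hr
  rw [Function.comp_apply, ← hXY _ ((extChartAt (𝓡 m) p).map_source hr),
    (extChartAt (𝓡 m) p).left_inv hr]

theorem mvfderiv_apply_of_chart {W : Type*} [NormedAddCommGroup W] [NormedSpace ℝ W] {X : M → W}
    {Y : EuclideanSpace ℝ (Fin m) → W}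
    (hXY : ∀ y ∈ (extChartAt (𝓡 m) p).target, X ((extChartAt (𝓡 m) p).symm y) = Y y)
    {q : M} (hq : q ∈ (extChartAt (𝓡 m) p).source)
    (hY : DifferentiableAt ℝ Y (extChartAt (𝓡 m) p q)) (v : TangentSpace (𝓡 m) q) :
    mvfderiv (𝓡 m) X q v = fderiv ℝ Y (extChartAt (𝓡 m) p q)
      (mfderiv (𝓡 m) 𝓘(ℝ, EuclideanSpace ℝ (Fin m)) (extChartAt (𝓡 m) p) q v) := by
  have hψ : MDifferentiableAt (𝓡 m) 𝓘(ℝ, EuclideanSpace ℝ (Fin m)) (extChartAt (𝓡 m) p) q :=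
    mdifferentiableAt_extChartAt (by simpa using hq)
  have h1 : mfderiv (𝓡 m) 𝓘(ℝ, W) (Y ∘ extChartAt (𝓡 m) p) q v =
      fderiv ℝ Y (extChartAt (𝓡 m) p q)
        (mfderiv (𝓡 m) 𝓘(ℝ, EuclideanSpace ℝ (Fin m)) (extChartAt (𝓡 m) p) q v) := by
    rw [← mfderiv_eq_fderiv]
    exact mfderiv_comp_apply q hY.mdifferentiableAt hψ v
  have h2 := (eventuallyEq_comp_extChartAt p hXY hq).mfderiv_eq (I := 𝓡 m) (I' := 𝓘(ℝ, W))
  exact (congrArg (fun A : EuclideanSpace ℝ (Fin m) →L[ℝ] W => A v) h2).trans h1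

/-- Derivatives on `M`, read in the chart at `p`. -/
theorem mvfderiv_symm_apply {W : Type*} [NormedAddCommGroup W] [NormedSpace ℝ W] {X : M → W}
    (hx : x ∈ (extChartAt (𝓡 m) p).target) {Y : EuclideanSpace ℝ (Fin m) → W}
    (hXY : ∀ y ∈ (extChartAt (𝓡 m) p).target, X ((extChartAt (𝓡 m) p).symm y) = Y y)
    (hY : DifferentiableAt ℝ Y x) (v : TangentSpace (𝓡 m) ((extChartAt (𝓡 m) p).symm x)) :
    mvfderiv (𝓡 m) X ((extChartAt (𝓡 m) p).symm x) v = fderiv ℝ Y x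
      (mfderiv (𝓡 m) 𝓘(ℝ, EuclideanSpace ℝ (Fin m)) (extChartAt (𝓡 m) p)
        ((extChartAt (𝓡 m) p).symm x) v) := by
  have hr := (extChartAt (𝓡 m) p).right_inv hx
  exact (mvfderiv_apply_of_chart p hXY ((extChartAt (𝓡 m) p).map_target hx)
    (hr.symm ▸ hY) v).trans (congrArg (fun z => fderiv ℝ Y z _) hr)

theorem isInvertible_mfderiv_chart (hx : x ∈ (extChartAt (𝓡 m) p).target) :
    (mfderiv (𝓡 m) 𝓘(ℝ, EuclideanSpace ℝ (Fin m)) (extChartAt (𝓡 m) p)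
        ((extChartAt (𝓡 m) p).symm x)).IsInvertible :=
  isInvertible_mfderiv_extChartAt ((extChartAt (𝓡 m) p).map_target hx)

/-! ### The tangent frame of an immersion in a chart -/

section Frame

variable (hφ : IsImmersedSubmanifold m φ) (hx : x ∈ (extChartAt (𝓡 m) p).target)
include hφ hx

theorem differentiableAt_inChart : DifferentiableAt ℝ (inChart φ p) x :=
  ((contDiffOn_inChart p hφ).contDiffAt ((isOpen_target p).mem_nhds hx)).differentiableAt
    (by simp)

theorem tangentMapAt_symm (v : TangentSpace (𝓡 m) ((extChartAt (𝓡 m) p).symm x)) :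
    tangentMapAt m φ ((extChartAt (𝓡 m) p).symm x) v = fderiv ℝ (inChart φ p) x
      (mfderiv (𝓡 m) 𝓘(ℝ, EuclideanSpace ℝ (Fin m)) (extChartAt (𝓡 m) p)
        ((extChartAt (𝓡 m) p).symm x) v) :=
  mvfderiv_symm_apply p hx (fun _ _ => rfl) (differentiableAt_inChart p hφ hx) v

theorem fderiv_inChart_injective : Function.Injective (fderiv ℝ (inChart φ p) x) := by
  intro v w hvw
  obtain ⟨v', rfl⟩ := (isInvertible_mfderiv_chart p hx).surjective v
  obtain ⟨w', rfl⟩ := (isInvertible_mfderiv_chart p hx).surjective w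
  rw [← tangentMapAt_symm p hφ hx, ← tangentMapAt_symm p hφ hx] at hvw
  rw [tangentMapAt_injective hφ _ hvw]

theorem tangentPlane_symm : tangentPlane m φ ((extChartAt (𝓡 m) p).symm x) =
    LinearMap.range (fderiv ℝ (inChart φ p) x).toLinearMap := by
  ext w
  constructor
  · rintro ⟨v, rfl⟩
    exact ⟨_, (tangentMapAt_symm p hφ hx v).symm⟩
  · rintro ⟨v, rfl⟩
    obtain ⟨v', rfl⟩ := (isInvertible_mfderiv_chart p hx).surjective v
    exact ⟨v', tangentMapAt_symm p hφ hx v'⟩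

theorem tanProj_symm (w : Ambient n) :
    tanProj m φ ((extChartAt (𝓡 m) p).symm x) w = chartProj φ p x w := by
  have hL := fderiv_inChart_injective p hφ hx
  refine Submodule.eq_starProjection_of_mem_of_inner_eq_zero ?_ ?_
  · rw [tangentPlane_symm p hφ hx]; exact ⟨_, rfl⟩
  · rw [tangentPlane_symm p hφ hx]
    rintro _ ⟨v, rfl⟩
    have h1 := inner_apply_pseudoInverse hL w (fderiv ℝ (inChart φ p) x v)
    rw [pseudoInverse_apply_apply hL] at h1
    rw [inner_sub_left, sub_eq_zero]
    exact h1.symm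

omit hx in
theorem tangentFrame_inChart : TangentFrame (extChartAt (𝓡 m) p).target (inChart φ p)
    (chartProj φ p) (chartInv φ p) := by
  have hfd : ContDiffOn ℝ ∞ (fderiv ℝ (inChart φ p)) (extChartAt (𝓡 m) p).target :=
    (contDiffOn_inChart p hφ).fderiv_of_isOpen (isOpen_target p) (by simp)
  have hinv : ContDiffOn ℝ ∞ (chartInv φ p) (extChartAt (𝓡 m) p).target := fun x hx =>
    (contDiffAt_pseudoInverse (fderiv_inChart_injective p hφ hx)).comp_contDiffWithinAt x
      (hfd x hx)
  exact
    { isOpen := isOpen_target p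
      contDiffOn := contDiffOn_inChart p hφ
      contDiffOn_proj := hfd.clm_comp hinv
      contDiffOn_inv := hinv
      fderiv_apply_inv := fun _ _ _ => rfl
      inv_fderiv := fun x hx w => pseudoInverse_apply_apply (fderiv_inChart_injective p hφ hx) w
      inner_proj := fun x hx u v =>
        inner_apply_pseudoInverse (fderiv_inChart_injective p hφ hx) u v
      norm_eq_one := fun x _ => by simp [inChart] }

omit [IsManifold (𝓡 m) ∞ M] hx p in
theorem tangentMapAt_tangentLift (q : M) (w : Ambient n) :
    tangentMapAt m φ q (tangentLift m φ q w) = tanProj m φ q w := by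
  have h0 : tanProj m φ q w ∈ tangentPlane m φ q := Submodule.starProjection_apply_mem _ _
  obtain ⟨v, hv⟩ := h0
  -- `LinearMap.leftInverse` inverts only maps with trivial kernel, so the immersion hypothesis
  -- enters here.
  rw [tangentLift, ← hv, LinearMap.leftInverse_apply_of_inj
    (LinearMap.ker_eq_bot.2 (tangentMapAt_injective hφ q))]
  rfl

theorem dirDeriv_symm {X : M → Ambient n} {Y : EuclideanSpace ℝ (Fin m) → Ambient n}
    (hXY : ∀ y ∈ (extChartAt (𝓡 m) p).target, X ((extChartAt (𝓡 m) p).symm y) = Y y)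
    (hY : DifferentiableAt ℝ Y x) (u : Ambient n) :
    dirDeriv m φ X ((extChartAt (𝓡 m) p).symm x) u = along (chartInv φ p) Y x u := by
  rw [dirDeriv, mvfderiv_symm_apply p hx hXY hY, along]
  congr 1
  -- The two tangent vectors are compared after applying the injective `df`, which sends both to the
  -- projection of `u`.
  apply fderiv_inChart_injective p hφ hx
  rw [← tangentMapAt_symm p hφ hx, tangentMapAt_tangentLift hφ, tanProj_symm p hφ hx]
  rfl

theorem norProj_symm (w : Ambient n) : norProj m φ ((extChartAt (𝓡 m) p).symm x) w =
    w - ⟪inChart φ p x, w⟫ • inChart φ p x - chartProj φ p x w := by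
  have hF := tangentFrame_inChart p hφ
  refine Submodule.eq_starProjection_of_mem_of_inner_eq_zero ?_ ?_
  · refine ⟨?_, ?_⟩
    · rw [tangentPlane_symm p hφ hx]
      refine (Submodule.mem_orthogonal' _ _).2 ?_
      rintro _ ⟨v, rfl⟩
      have hv : chartProj φ p x (fderiv ℝ (inChart φ p) x v) = fderiv ℝ (inChart φ p) x v := by
        rw [← hF.fderiv_apply_inv x hx, hF.inv_fderiv x hx]
      refine hF.inner_eq_zero_of_proj_eq_zero hx ?_ hv
      rw [map_sub, map_sub, map_smul, hF.proj_position hx, hF.proj_proj hx, smul_zero, sub_zero,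
        sub_self]
    · refine Submodule.mem_orthogonal_singleton_iff_inner_right.2 ?_
      change ⟪inChart φ p x, _⟫ = 0
      rw [inner_sub_right, inner_sub_right, inner_smul_right, hF.inner_self_eq_one hx,
        hF.inner_position_proj hx]
      ring
  · intro z hz
    have h1 : ⟪inChart φ p x, z⟫ = 0 := Submodule.mem_orthogonal_singleton_iff_inner_right.1 hz.2
    have h2 : ⟪chartProj φ p x w, z⟫ = 0 := by
      rw [← tanProj_symm p hφ hx]
      exact Submodule.inner_right_of_mem_orthogonal (Submodule.starProjection_apply_mem _ _) hz.1
    rw [inner_sub_left, inner_sub_left, inner_sub_left, inner_smul_left, h1, h2]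
    simp

end Frame

end Chart

/-! ### Second fundamental form and Laplacians in a chart -/

section ChartGeometry

variable {m n : ℕ} {M : Type*} [TopologicalSpace M] [ChartedSpace (EuclideanSpace ℝ (Fin m)) M]
  [IsManifold (𝓡 m) ∞ M] {φ : M → UnitSphere n}

variable (p : M) {x : EuclideanSpace ℝ (Fin m)}
  (hφ : IsImmersedSubmanifold m φ) (hx : x ∈ (extChartAt (𝓡 m) p).target)
include hφ hx

theorem nabla_symm {X : M → Ambient n} {Y : EuclideanSpace ℝ (Fin m) → Ambient n}
    (hXY : ∀ y ∈ (extChartAt (𝓡 m) p).target, X ((extChartAt (𝓡 m) p).symm y) = Y y)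
    (hY : DifferentiableAt ℝ Y x) (u : Ambient n) :
    nabla m φ X ((extChartAt (𝓡 m) p).symm x) u = along (chartInv φ p) Y x u
      - ⟪inChart φ p x, along (chartInv φ p) Y x u⟫ • inChart φ p x := by
  rw [nabla, sphereProj_unit (by simp), dirDeriv_symm p hφ hx hXY hY]
  rfl

theorem norProj_nabla_symm {X : M → Ambient n} {Y : EuclideanSpace ℝ (Fin m) → Ambient n}
    (hXY : ∀ y ∈ (extChartAt (𝓡 m) p).target, X ((extChartAt (𝓡 m) p).symm y) = Y y)
    (hY : DifferentiableAt ℝ Y x) (u : Ambient n) :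
    nablaN m φ X ((extChartAt (𝓡 m) p).symm x) u = along (chartInv φ p) Y x u
      - ⟪inChart φ p x, along (chartInv φ p) Y x u⟫ • inChart φ p x
      - chartProj φ p x (along (chartInv φ p) Y x u) := by
  have hF := tangentFrame_inChart p hφ
  rw [nablaN, nabla_symm p hφ hx hXY hY, norProj_symm p hφ hx]
  simp only [map_sub, map_smul, hF.proj_position hx, inner_sub_right, inner_smul_right,
    hF.inner_self_eq_one hx]
  simp

theorem nabla_tanExtend_symm (u v : Ambient n) :
    nabla m φ (tanExtend m φ v) ((extChartAt (𝓡 m) p).symm x) u =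
      along (chartInv φ p) (chartProj φ p) x u v
      - ⟪inChart φ p x, along (chartInv φ p) (chartProj φ p) x u v⟫ • inChart φ p x := by
  have hF := tangentFrame_inChart p hφ
  have hP := hF.differentiableAt hx hF.contDiffOn_proj
  rw [nabla_symm p hφ hx (Y := fun y => chartProj φ p y v)
    (fun y hy => tanProj_symm p hφ hy v) (hP.clm_apply (differentiableAt_const v)),
    along_clm_apply_const _ u hP]

/-- For tangent `v` the right side is zero: the extension of `v` is parallel at the base point,
which removes the correction term of `secondCovDeriv`. -/
theorem nablaT_tanExtend_symm (u v : Ambient n) :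
    nablaT m φ (tanExtend m φ v) ((extChartAt (𝓡 m) p).symm x) u =
      chartProj φ p x (along (chartInv φ p) (chartProj φ p) x u v) := by
  have hF := tangentFrame_inChart p hφ
  rw [nablaT, nabla_tanExtend_symm p hφ hx, tanProj_symm p hφ hx, map_sub, map_smul,
    hF.proj_position hx, smul_zero, sub_zero]

theorem nablaTangentMap_symm (u v : Ambient n) :
    nablaTangentMap m φ ((extChartAt (𝓡 m) p).symm x) u v =
      along (chartInv φ p) (chartProj φ p) x u v
      - ⟪inChart φ p x, along (chartInv φ p) (chartProj φ p) x u v⟫ • inChart φ p x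
      - chartProj φ p x (along (chartInv φ p) (chartProj φ p) x u v) := by
  rw [nablaTangentMap, nabla_tanExtend_symm p hφ hx, nablaT_tanExtend_symm p hφ hx]

theorem secondFundamentalForm_symm (u v : Ambient n) :
    secondFundamentalForm m φ ((extChartAt (𝓡 m) p).symm x) u v =
      along (chartInv φ p) (chartProj φ p) x u v
      - ⟪inChart φ p x, along (chartInv φ p) (chartProj φ p) x u v⟫ • inChart φ p x
      - chartProj φ p x (along (chartInv φ p) (chartProj φ p) x u v) := by
  have hF := tangentFrame_inChart p hφ
  rw [secondFundamentalForm, nabla_tanExtend_symm p hφ hx, norProj_symm p hφ hx]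
  simp only [map_sub, map_smul, hF.proj_position hx, inner_sub_right, inner_smul_right,
    hF.inner_self_eq_one hx]
  simp

variable (φ) in
/-- The trace of the second fundamental form, read in the chart at `p`. -/
def chartTension (p : M) (x : EuclideanSpace ℝ (Fin m)) : Ambient n :=
  TangentFrame.euclideanTension (chartProj φ p) (chartInv φ p)
      (EuclideanSpace.basisFun (Fin (n + 1)) ℝ) x
    - ⟪inChart φ p x, TangentFrame.euclideanTension (chartProj φ p) (chartInv φ p)
      (EuclideanSpace.basisFun (Fin (n + 1)) ℝ) x⟫ • inChart φ p x

theorem traceG_secondFundamentalForm_symm :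
    traceG m φ ((extChartAt (𝓡 m) p).symm x)
      (secondFundamentalForm m φ ((extChartAt (𝓡 m) p).symm x)) = chartTension φ p x := by
  have hF := tangentFrame_inChart p hφ
  have hK := tanProj_symm p hφ hx
  have h1 := hF.sum_along_proj hx (EuclideanSpace.basisFun (Fin (n + 1)) ℝ)
    (stdOrthonormalBasis ℝ (tangentPlane m φ ((extChartAt (𝓡 m) p).symm x))) hK
  simp only [traceG, secondFundamentalForm_symm p hφ hx]
  rw [Finset.sum_sub_distrib, Finset.sum_sub_distrib, ← Finset.sum_smul, ← inner_sum, ← map_sum,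
    h1, hF.proj_euclideanTension hx _
      (stdOrthonormalBasis ℝ (tangentPlane m φ ((extChartAt (𝓡 m) p).symm x))) hK, sub_zero]
  rfl

theorem proj_chartTension : chartProj φ p x (chartTension φ p x) = 0 := by
  have hF := tangentFrame_inChart p hφ
  rw [chartTension, map_sub, map_smul, hF.proj_position hx, hF.proj_euclideanTension hx _
      (stdOrthonormalBasis ℝ (tangentPlane m φ ((extChartAt (𝓡 m) p).symm x)))
      (tanProj_symm p hφ hx)]
  simp

theorem inner_position_chartTension : ⟪inChart φ p x, chartTension φ p x⟫ = 0 := by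
  have hF := tangentFrame_inChart p hφ
  rw [chartTension, inner_sub_right, inner_smul_right, hF.inner_self_eq_one hx]
  ring

omit hx in
theorem contDiffOn_chartTension :
    ContDiffOn ℝ ∞ (chartTension φ p) (extChartAt (𝓡 m) p).target := by
  have hF := tangentFrame_inChart p hφ
  have h1 := hF.contDiffOn_euclideanTension (EuclideanSpace.basisFun (Fin (n + 1)) ℝ)
  exact h1.sub ((hF.contDiffOn.inner ℝ h1).smul hF.contDiffOn)

/-- `dP(u)` is symmetric and sends `ξ` to a tangent vector, so the sum in `weingarten` is the
expansion of that vector in the orthonormal basis. -/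
theorem weingarten_symm {ξ : Ambient n} (hξ : chartProj φ p x ξ = 0)
    (hξ' : ⟪inChart φ p x, ξ⟫ = 0) (u : Ambient n) :
    weingarten m φ ((extChartAt (𝓡 m) p).symm x) ξ u =
      along (chartInv φ p) (chartProj φ p) x u ξ := by
  have hF := tangentFrame_inChart p hφ
  have hK := tanProj_symm p hφ hx
  set b := stdOrthonormalBasis ℝ (tangentPlane m φ ((extChartAt (𝓡 m) p).symm x))
  have h1 : ∀ i, ⟪secondFundamentalForm m φ ((extChartAt (𝓡 m) p).symm x) u (b i), ξ⟫ =
      ⟪(b i : Ambient n), along (chartInv φ p) (chartProj φ p) x u ξ⟫ := by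
    intro i
    rw [secondFundamentalForm_symm p hφ hx, hF.proj_along_proj_of_tangent hx u
      (TangentFrame.proj_basis b hK i), sub_zero, inner_sub_left, inner_smul_left, hξ',
      hF.inner_along_proj hx]
    simp
  have h2 : along (chartInv φ p) (chartProj φ p) x u ξ =
      (tangentPlane m φ ((extChartAt (𝓡 m) p).symm x)).starProjection
        (along (chartInv φ p) (chartProj φ p) x u ξ) := by
    rw [← hF.proj_along_proj_of_normal hx u hξ, ← hK, tanProj]
    exact (Submodule.starProjection_eq_self_iff.2 (Submodule.starProjection_apply_mem _ _)).symm
  rw [h2, Submodule.starProjection_apply, b.orthogonalProjectionOnto_apply_eq_sum]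
  simp only [weingarten]
  rw [AddSubmonoidClass.coe_finsetSum]
  refine Finset.sum_congr rfl fun i _ => ?_
  rw [h1]
  rfl

/-! ### Second covariant derivatives of a normal field -/

section NormalField

variable {X : M → Ambient n} {Y : EuclideanSpace ℝ (Fin m) → Ambient n}
    (hXY : ∀ y ∈ (extChartAt (𝓡 m) p).target, X ((extChartAt (𝓡 m) p).symm y) = Y y)
    (hY : ContDiffOn ℝ ∞ Y (extChartAt (𝓡 m) p).target)
    (hP : ∀ y ∈ (extChartAt (𝓡 m) p).target, chartProj φ p y (Y y) = 0)
    (hf : ∀ y ∈ (extChartAt (𝓡 m) p).target, ⟪inChart φ p y, Y y⟫ = 0)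
include hXY hY hP hf

theorem nabla_normal_symm (u : Ambient n) :
    nabla m φ X ((extChartAt (𝓡 m) p).symm x) u = along (chartInv φ p) Y x u := by
  have hF := tangentFrame_inChart p hφ
  rw [nabla_symm p hφ hx hXY (hF.differentiableAt hx hY),
    hF.inner_position_along_normal hx hY hP hf]
  simp

theorem nablaN_normal_symm (u : Ambient n) :
    nablaN m φ X ((extChartAt (𝓡 m) p).symm x) u =
      along (chartInv φ p) Y x u - chartProj φ p x (along (chartInv φ p) Y x u) := by
  have hF := tangentFrame_inChart p hφ
  rw [norProj_nabla_symm p hφ hx hXY (hF.differentiableAt hx hY),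
    hF.inner_position_along_normal hx hY hP hf]
  simp

theorem secondCovDeriv_nabla_symm {e : Ambient n} (he : chartProj φ p x e = e) :
    secondCovDeriv m φ (nabla m φ) X ((extChartAt (𝓡 m) p).symm x) e e =
      along (chartInv φ p) (fun y => along (chartInv φ p) Y y e) x e
        - ⟪inChart φ p x, along (chartInv φ p) (fun y => along (chartInv φ p) Y y e) x e⟫
          • inChart φ p x := by
  have hF := tangentFrame_inChart p hφ
  rw [secondCovDeriv, nablaT_tanExtend_symm p hφ hx, hF.proj_along_proj_of_tangent hx e he,
    nabla_normal_symm p hφ hx hXY hY hP hf 0, along_zero_right, sub_zero]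
  refine nabla_symm p hφ hx (fun y hy => ?_) (hF.differentiableAt hx (hF.contDiffOn_along hY e)) e
  rw [nabla_normal_symm p hφ hy hXY hY hP hf, tanExtend, tanProj_symm p hφ hy, hF.along_proj hy]

theorem secondCovDeriv_nablaN_symm {e : Ambient n} (he : chartProj φ p x e = e) :
    secondCovDeriv m φ (nablaN m φ) X ((extChartAt (𝓡 m) p).symm x) e e =
      along (chartInv φ p) (fun y => along (chartInv φ p) Y y e
        - chartProj φ p y (along (chartInv φ p) Y y e)) x e
      - ⟪inChart φ p x, along (chartInv φ p) (fun y => along (chartInv φ p) Y y e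
        - chartProj φ p y (along (chartInv φ p) Y y e)) x e⟫ • inChart φ p x
      - chartProj φ p x (along (chartInv φ p) (fun y => along (chartInv φ p) Y y e
        - chartProj φ p y (along (chartInv φ p) Y y e)) x e) := by
  have hF := tangentFrame_inChart p hφ
  have hd := hF.differentiableAt hx (hF.contDiffOn_along hY e)
  have hPd := hF.differentiableAt hx hF.contDiffOn_proj
  rw [secondCovDeriv, nablaT_tanExtend_symm p hφ hx, hF.proj_along_proj_of_tangent hx e he,
    nablaN_normal_symm p hφ hx hXY hY hP hf 0, along_zero_right, map_zero, sub_zero, sub_zero]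
  refine norProj_nabla_symm p hφ hx (fun y hy => ?_) (hd.fun_sub (hPd.clm_apply hd)) e
  rw [nablaN_normal_symm p hφ hy hXY hY hP hf, tanExtend, tanProj_symm p hφ hy,
    hF.along_proj hy]

/-- The normal part of `∇²_{e,e} X` for a normal field `X`. -/
theorem secondCovDeriv_nabla_normal_part {e : Ambient n} (he : chartProj φ p x e = e) :
    secondCovDeriv m φ (nabla m φ) X ((extChartAt (𝓡 m) p).symm x) e e
      - chartProj φ p x (secondCovDeriv m φ (nabla m φ) X ((extChartAt (𝓡 m) p).symm x) e e) =
    secondCovDeriv m φ (nablaN m φ) X ((extChartAt (𝓡 m) p).symm x) e e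
      - secondFundamentalForm m φ ((extChartAt (𝓡 m) p).symm x) e
        (weingarten m φ ((extChartAt (𝓡 m) p).symm x) (Y x) e) := by
  have hF := tangentFrame_inChart p hφ
  rw [secondCovDeriv_nabla_symm p hφ hx hXY hY hP hf he,
    secondCovDeriv_nablaN_symm p hφ hx hXY hY hP hf he, weingarten_symm p hφ hx (hP x hx) (hf x hx),
    secondFundamentalForm_symm p hφ hx,
    hF.proj_along_proj_of_tangent hx e (hF.proj_along_proj_of_normal hx e (hP x hx))]
  have h1 := hF.along_along_normal hx hY hP e
  -- The position components of the identity are compared separately, because both covariant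
  -- derivatives remove them.
  have h2 := congrArg (fun z => ⟪inChart φ p x, z⟫) h1
  simp only [inner_sub_right, hF.inner_position_proj hx, sub_zero] at h2
  rw [h2, map_sub, map_smul, hF.proj_position hx, smul_zero, sub_zero, sub_right_comm, h1, sub_smul]
  abel

end NormalField

end ChartGeometry

/-! ### Normal and tangential part of the bitension field -/

section Global

variable {m n : ℕ} {M : Type*} [TopologicalSpace M] [ChartedSpace (EuclideanSpace ℝ (Fin m)) M]
  {φ : M → UnitSphere n}

theorem traceG_congr {q : M} {Q Q' : Ambient n → Ambient n → Ambient n}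
    (h : ∀ e ∈ tangentPlane m φ q, Q e e = Q' e e) : traceG m φ q Q = traceG m φ q Q' :=
  Finset.sum_congr rfl fun i _ => h _ (stdOrthonormalBasis ℝ (tangentPlane m φ q) i).2

theorem traceG_sub {q : M} (Q Q' : Ambient n → Ambient n → Ambient n) :
    traceG m φ q (fun u v => Q u v - Q' u v) = traceG m φ q Q - traceG m φ q Q' :=
  Finset.sum_sub_distrib _ _

theorem traceG_smul {q : M} (c : ℝ) (Q : Ambient n → Ambient n → Ambient n) :
    traceG m φ q (fun u v => c • Q u v) = c • traceG m φ q Q :=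
  (Finset.smul_sum ..).symm

theorem map_traceG {W : Type*} [AddCommGroup W] [Module ℝ W] {q : M} (A : Ambient n →ₗ[ℝ] W)
    (Q : Ambient n → Ambient n → Ambient n) :
    A (traceG m φ q Q) = ∑ i, A (Q (stdOrthonormalBasis ℝ (tangentPlane m φ q) i)
      (stdOrthonormalBasis ℝ (tangentPlane m φ q) i)) :=
  map_sum A _ _

theorem finrank_tangentPlane (hφ : IsImmersedSubmanifold m φ) (q : M) :
    Module.finrank ℝ (tangentPlane m φ q) = m := by
  rw [tangentPlane, LinearMap.finrank_range_of_inj (tangentMapAt_injective hφ q)]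
  exact finrank_euclideanSpace_fin

theorem traceG_eq_zero (hφ : IsImmersedSubmanifold m φ) (hm : m = 0) (q : M)
    (Q : Ambient n → Ambient n → Ambient n) : traceG m φ q Q = 0 := by
  have h0 : Module.finrank ℝ (tangentPlane m φ q) = 0 := by rw [finrank_tangentPlane hφ, hm]
  have : IsEmpty (Fin (Module.finrank ℝ (tangentPlane m φ q))) := by rw [h0]; infer_instance
  exact Finset.sum_of_isEmpty _

/-- Also true for `m = 0`, where `1 / 0 = 0` and the trace is an empty sum. -/
theorem smul_meanCurvature (hφ : IsImmersedSubmanifold m φ) (q : M) :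
    (m : ℝ) • meanCurvature m φ q = traceG m φ q (secondFundamentalForm m φ q) := by
  rcases Nat.eq_zero_or_pos m with hm | hm
  · rw [meanCurvature, traceG_eq_zero hφ hm]; simp
  · have : (m : ℝ) ≠ 0 := by positivity
    rw [meanCurvature, smul_smul, mul_one_div_cancel this, one_smul]

variable [IsManifold (𝓡 m) ∞ M] (hφ : IsImmersedSubmanifold m φ)

/-! ### Mean curvature and bitension field in a chart -/

section Symm

variable (p : M) {x : EuclideanSpace ℝ (Fin m)} (hx : x ∈ (extChartAt (𝓡 m) p).target)
include hφ hx

theorem meanCurvature_symm : meanCurvature m φ ((extChartAt (𝓡 m) p).symm x) =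
    (1 / (m : ℝ)) • chartTension φ p x := by
  rw [meanCurvature, traceG_secondFundamentalForm_symm p hφ hx]

theorem deltaT_symm : deltaT m φ ((extChartAt (𝓡 m) p).symm x) =
    (-(m : ℝ)) • ((1 / (m : ℝ)) • chartTension φ p x) := by
  rw [← meanCurvature_symm hφ p hx, neg_smul, smul_meanCurvature hφ, deltaT]
  congr 1
  exact traceG_congr fun e _ => by
    rw [nablaTangentMap_symm p hφ hx, secondFundamentalForm_symm p hφ hx]

theorem proj_smul_chartTension (r : ℝ) : chartProj φ p x (r • chartTension φ p x) = 0 := by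
  rw [map_smul, proj_chartTension p hφ hx, smul_zero]

theorem inner_position_smul_chartTension (r : ℝ) :
    ⟪inChart φ p x, r • chartTension φ p x⟫ = 0 := by
  rw [inner_smul_right, inner_position_chartTension p hφ hx, mul_zero]

omit hx in
theorem contDiffOn_smul_chartTension (r : ℝ) :
    ContDiffOn ℝ ∞ (fun y => r • chartTension φ p y) (extChartAt (𝓡 m) p).target :=
  (contDiffOn_chartTension p hφ).const_smul r

theorem proj_eq_self_of_mem {e : Ambient n}
    (he : e ∈ tangentPlane m φ ((extChartAt (𝓡 m) p).symm x)) : chartProj φ p x e = e := by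
  rw [← tanProj_symm p hφ hx]; exact Submodule.starProjection_eq_self_iff.2 he

theorem secondCovDeriv_deltaT_symm {e : Ambient n} (he : chartProj φ p x e = e) :
    secondCovDeriv m φ (nabla m φ) (deltaT m φ) ((extChartAt (𝓡 m) p).symm x) e e =
      (-(m : ℝ)) • secondCovDeriv m φ (nabla m φ) (meanCurvature m φ)
        ((extChartAt (𝓡 m) p).symm x) e e := by
  have hF := tangentFrame_inChart p hφ
  have hH := contDiffOn_smul_chartTension (φ := φ) hφ p (1 / (m : ℝ))
  have hd := hF.differentiableAt hx (hF.contDiffOn_along hH e)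
  rw [secondCovDeriv_nabla_symm p hφ hx (fun y hy => deltaT_symm hφ p hy)
      (hH.const_smul (-(m : ℝ)))
      (fun y hy => by rw [map_smul, proj_smul_chartTension hφ p hy, smul_zero])
      (fun y hy => by rw [inner_smul_right, inner_position_smul_chartTension hφ p hy, mul_zero]) he,
    secondCovDeriv_nabla_symm p hφ hx (fun y hy => meanCurvature_symm hφ p hy) hH
      (fun y hy => proj_smul_chartTension hφ p hy _)
      (fun y hy => inner_position_smul_chartTension hφ p hy _) he,
    along_congr _ e hF.isOpen hx (fun y hy => along_const_smul _ e
      (hF.differentiableAt hy hH) (-(m : ℝ))), along_const_smul _ e hd, inner_smul_right, smul_sub,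
    smul_smul]

/-- Each unit tangent vector `e` contributes `|e|² ξ - ⟨ξ, e⟩ e = ξ`, and there are `m` of them. -/
theorem curvatureEnd_symm {ξ : Ambient n} (hξ : chartProj φ p x ξ = 0)
    (hξ' : ⟪inChart φ p x, ξ⟫ = 0) :
    curvatureEnd m φ ((extChartAt (𝓡 m) p).symm x) ξ = (m : ℝ) • ξ := by
  have hF := tangentFrame_inChart p hφ
  set b := stdOrthonormalBasis ℝ (tangentPlane m φ ((extChartAt (𝓡 m) p).symm x)) with hb
  have h1 : ∀ i, sphereCurvature (φ ((extChartAt (𝓡 m) p).symm x) : Ambient n) ξ (b i) (b i) = ξ := by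
    intro i
    have hbi := proj_eq_self_of_mem hφ p hx (b i).2
    have h2 : ⟪inChart φ p x, (b i : Ambient n)⟫ = 0 := by
      rw [← hbi]; exact hF.inner_position_proj hx _
    have h3 : ⟪(b i : Ambient n), (b i : Ambient n)⟫ = 1 := by
      have := b.orthonormal.1 i
      rw [real_inner_self_eq_norm_sq, ← Submodule.coe_norm, this, one_pow]
    refine (sphereCurvature_eq (hF.norm_eq_one x hx) hξ' h2 h2).trans ?_
    rw [h3, hF.inner_eq_zero_of_proj_eq_zero hx hξ hbi]
    simp
  simp only [curvatureEnd, traceG, ← hb, h1]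
  rw [Finset.sum_const, Finset.card_univ, Fintype.card_fin, finrank_tangentPlane hφ,
    Nat.cast_smul_eq_nsmul]

theorem mvfderiv_meanCurvature_symm (v : TangentSpace (𝓡 m) ((extChartAt (𝓡 m) p).symm x)) :
    mvfderiv (𝓡 m) (fun q : M => ‖meanCurvature m φ q‖ ^ 2) ((extChartAt (𝓡 m) p).symm x) v =
      2 * ⟪(1 / (m : ℝ)) • chartTension φ p x,
        along (chartInv φ p) (fun y => (1 / (m : ℝ)) • chartTension φ p y) x
          (tangentMapAt m φ ((extChartAt (𝓡 m) p).symm x) v)⟫ := by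
  have hF := tangentFrame_inChart p hφ
  have hd := hF.differentiableAt hx (contDiffOn_smul_chartTension (φ := φ) hφ p (1 / (m : ℝ)))
  have h1 : ∀ y ∈ (extChartAt (𝓡 m) p).target,
      (fun q : M => ‖meanCurvature m φ q‖ ^ 2) ((extChartAt (𝓡 m) p).symm y) =
        ⟪(1 / (m : ℝ)) • chartTension φ p y, (1 / (m : ℝ)) • chartTension φ p y⟫ := by
    intro y hy
    simp only
    rw [meanCurvature_symm hφ p hy, real_inner_self_eq_norm_sq]
  have h2 : along (chartInv φ p) (fun y => (1 / (m : ℝ)) • chartTension φ p y) x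
      (tangentMapAt m φ ((extChartAt (𝓡 m) p).symm x) v) =
      fderiv ℝ (fun y => (1 / (m : ℝ)) • chartTension φ p y) x
        (mfderiv (𝓡 m) 𝓘(ℝ, EuclideanSpace ℝ (Fin m)) (extChartAt (𝓡 m) p)
          ((extChartAt (𝓡 m) p).symm x) v) := by
    rw [tangentMapAt_symm p hφ hx, along]
    exact congrArg _ (hF.inv_fderiv x hx _)
  rw [h2]
  refine (mvfderiv_symm_apply p hx h1 (hd.inner ℝ hd) v).trans
    ((fderiv_inner_apply ℝ hd hd _).trans ?_)
  rw [two_mul]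
  congr 1
  exact real_inner_comm _ _

/-- The tangential part of the rough Laplacian of the mean curvature. -/
theorem inner_laplacian_meanCurvature_symm (hm : m ≠ 0)
    (v : TangentSpace (𝓡 m) ((extChartAt (𝓡 m) p).symm x)) :
    ⟪laplacian m φ (nabla m φ) (meanCurvature m φ) ((extChartAt (𝓡 m) p).symm x),
        tangentMapAt m φ ((extChartAt (𝓡 m) p).symm x) v⟫ =
      (m : ℝ) / 2 * mvfderiv (𝓡 m) (fun q : M => ‖meanCurvature m φ q‖ ^ 2)
          ((extChartAt (𝓡 m) p).symm x) v
        + 2 * ⟪traceG m φ ((extChartAt (𝓡 m) p).symm x) (fun u w =>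
            weingarten m φ ((extChartAt (𝓡 m) p).symm x)
              (nablaN m φ (meanCurvature m φ) ((extChartAt (𝓡 m) p).symm x) u) w),
          tangentMapAt m φ ((extChartAt (𝓡 m) p).symm x) v⟫ := by
  have hF := tangentFrame_inChart p hφ
  have hK := tanProj_symm p hφ hx
  have hm' : (m : ℝ) ≠ 0 := Nat.cast_ne_zero.2 hm
  rw [mvfderiv_meanCurvature_symm hφ p hx]
  have hw : chartProj φ p x (tangentMapAt m φ ((extChartAt (𝓡 m) p).symm x) v) =
      tangentMapAt m φ ((extChartAt (𝓡 m) p).symm x) v :=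
    proj_eq_self_of_mem hφ p hx ⟨v, rfl⟩
  generalize tangentMapAt m φ ((extChartAt (𝓡 m) p).symm x) v = w at hw
  set b := stdOrthonormalBasis ℝ (tangentPlane m φ ((extChartAt (𝓡 m) p).symm x)) with hb
  set Y : EuclideanSpace ℝ (Fin m) → Ambient n := fun y => (1 / (m : ℝ)) • chartTension φ p y
    with hYdef
  have hXY : ∀ y ∈ (extChartAt (𝓡 m) p).target,
      meanCurvature m φ ((extChartAt (𝓡 m) p).symm y) = Y y :=
    fun y hy => meanCurvature_symm hφ p hy
  have hY : ContDiffOn ℝ ∞ Y (extChartAt (𝓡 m) p).target :=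
    contDiffOn_smul_chartTension (φ := φ) hφ p (1 / (m : ℝ))
  have hP : ∀ y ∈ (extChartAt (𝓡 m) p).target, chartProj φ p y (Y y) = 0 :=
    fun y hy => proj_smul_chartTension hφ p hy _
  have hf : ∀ y ∈ (extChartAt (𝓡 m) p).target, ⟪inChart φ p y, Y y⟫ = 0 :=
    fun y hy => inner_position_smul_chartTension hφ p hy _
  have hfw : ⟪inChart φ p x, w⟫ = 0 := by rw [← hw]; exact hF.inner_position_proj hx _
  have hbi : ∀ i, chartProj φ p x (b i) = b i := TangentFrame.proj_basis b hK
  -- Weingarten term plus Codazzi: the derivative of `B` is already moved from `b i` to `w`, so that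
  -- the sum over `i` is the derivative of a trace.
  have h1 : ∀ i, ⟪secondCovDeriv m φ (nabla m φ) (meanCurvature m φ)
      ((extChartAt (𝓡 m) p).symm x) (b i) (b i), w⟫ =
      -2 * ⟪weingarten m φ ((extChartAt (𝓡 m) p).symm x)
        (nablaN m φ (meanCurvature m φ) ((extChartAt (𝓡 m) p).symm x) (b i)) (b i), w⟫
      - ⟪Y x, along (chartInv φ p)
          (fun y => along (chartInv φ p) (chartProj φ p) y (b i)) x w (b i)⟫ := by
    intro i
    rw [secondCovDeriv_nabla_symm p hφ hx hXY hY hP hf (hbi i),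
      nablaN_normal_symm p hφ hx hXY hY hP hf, weingarten_symm p hφ hx
        (by rw [map_sub, hF.proj_proj hx, sub_self])
        (by rw [inner_sub_right, hF.inner_position_along_normal hx hY hP hf,
          hF.inner_position_proj hx, sub_zero]),
      inner_sub_left, inner_smul_left, hfw, mul_zero, sub_zero,
      hF.inner_along_along_normal hx hY hP (b i) hw,
      hF.inner_along_along_proj_comm hx (hP x hx) (hbi i) hw, hF.inner_along_proj hx,
      inner_sub_left, hF.inner_proj x hx, hF.proj_along_proj_of_tangent hx _ hw, inner_zero_right,
      sub_zero]
  have h2 := hF.sum_inner_along_along_proj hx (EuclideanSpace.basisFun (Fin (n + 1)) ℝ) b hK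
    (hP x hx) w
  -- The factor `1 / m` in `H` is cancelled by the `m` in the statement; this uses `m ≠ 0`.
  have h3 := hF.inner_along_meanCurvature hx (EuclideanSpace.basisFun (Fin (n + 1)) ℝ)
    (X := Y) (r := 1 / (m : ℝ)) (fun y _ => rfl) (hP x hx) (hf x hx) w
  change _ = (m : ℝ) / 2 * (2 * ⟪Y x, along (chartInv φ p) Y x w⟫) + _
  rw [h3, ← h2, laplacian, inner_neg_left]
  simp only [traceG, ← hb]
  rw [sum_inner, sum_inner, Finset.sum_congr rfl fun i _ => h1 i, Finset.sum_sub_distrib,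
    ← Finset.mul_sum]
  field_simp
  ring

end Symm

/-! ### Pointwise identities on `M`, read in the chart centred at the point -/

include hφ

theorem deltaT_eq (q : M) : deltaT m φ q = (-(m : ℝ)) • meanCurvature m φ q := by
  have hx := mem_extChartAt_target (I := 𝓡 m) q
  have h1 := deltaT_symm hφ q hx
  rwa [← meanCurvature_symm hφ q hx, extChartAt_to_inv] at h1

theorem laplacian_deltaT (q : M) : laplacian m φ (nabla m φ) (deltaT m φ) q =
    (-(m : ℝ)) • laplacian m φ (nabla m φ) (meanCurvature m φ) q := by
  have hx := mem_extChartAt_target (I := 𝓡 m) q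
  have h1 := fun e he => secondCovDeriv_deltaT_symm hφ q hx
    (proj_eq_self_of_mem (e := e) hφ q hx he)
  rw [extChartAt_to_inv] at h1
  rw [laplacian, laplacian, smul_neg, ← traceG_smul]
  congr 1
  exact traceG_congr h1

theorem curvatureEnd_deltaT (q : M) : curvatureEnd m φ q (deltaT m φ q) =
    (m : ℝ) • deltaT m φ q := by
  have hx := mem_extChartAt_target (I := 𝓡 m) q
  have h1 := curvatureEnd_symm hφ q hx (ξ := deltaT m φ ((extChartAt (𝓡 m) q).symm _))
    (by rw [deltaT_symm hφ q hx, map_smul, proj_smul_chartTension hφ q hx, smul_zero])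
    (by rw [deltaT_symm hφ q hx, inner_smul_right, inner_position_smul_chartTension hφ q hx,
      mul_zero])
  rwa [extChartAt_to_inv] at h1

theorem tanProj_meanCurvature (q : M) : tanProj m φ q (meanCurvature m φ q) = 0 := by
  have hx := mem_extChartAt_target (I := 𝓡 m) q
  have h1 := tanProj_symm q hφ hx (meanCurvature m φ ((extChartAt (𝓡 m) q).symm (extChartAt (𝓡 m) q q)))
  rwa [meanCurvature_symm hφ q hx, proj_smul_chartTension hφ q hx, ← meanCurvature_symm hφ q hx,
    extChartAt_to_inv] at h1

/-- The normal part of the rough Laplacian of the mean curvature. -/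
theorem laplacian_meanCurvature_sub_tanProj (q : M) :
    laplacian m φ (nabla m φ) (meanCurvature m φ) q
      - tanProj m φ q (laplacian m φ (nabla m φ) (meanCurvature m φ) q) =
    laplacian m φ (nablaN m φ) (meanCurvature m φ) q + traceG m φ q (fun u v =>
      secondFundamentalForm m φ q u (weingarten m φ q (meanCurvature m φ q) v)) := by
  have hx := mem_extChartAt_target (I := 𝓡 m) q
  have h1 := fun e he => secondCovDeriv_nabla_normal_part q hφ hx
    (fun y hy => meanCurvature_symm hφ q hy)
    (contDiffOn_smul_chartTension (φ := φ) hφ q (1 / (m : ℝ)))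
    (fun y hy => proj_smul_chartTension hφ q hy _)
    (fun y hy => inner_position_smul_chartTension hφ q hy _)
    (proj_eq_self_of_mem (e := e) hφ q hx he)
  simp only [← meanCurvature_symm hφ q hx, ← tanProj_symm q hφ hx] at h1
  rw [extChartAt_to_inv] at h1
  have h2 := traceG_congr (m := m) (φ := φ) (q := q)
    (Q := fun u v => secondCovDeriv m φ (nabla m φ) (meanCurvature m φ) q u v
      - tanProj m φ q (secondCovDeriv m φ (nabla m φ) (meanCurvature m φ) q u v))
    (Q' := fun u v => secondCovDeriv m φ (nablaN m φ) (meanCurvature m φ) q u v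
      - secondFundamentalForm m φ q u (weingarten m φ q (meanCurvature m φ q) v)) h1
  rw [traceG_sub, traceG_sub] at h2
  have h3 : tanProj m φ q (laplacian m φ (nabla m φ) (meanCurvature m φ) q) =
      -traceG m φ q (fun u v =>
        tanProj m φ q (secondCovDeriv m φ (nabla m φ) (meanCurvature m φ) q u v)) := by
    rw [laplacian, tanProj, map_neg]
    congr 1
    exact map_traceG (tangentPlane m φ q).starProjection.toLinearMap _
  rw [h3, laplacian, laplacian, ← neg_inj]
  rw [neg_add, neg_neg, ← sub_eq_add_neg, ← h2]
  abel

theorem inner_laplacian_meanCurvature (hm : m ≠ 0) (q : M) (v : TangentSpace (𝓡 m) q) :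
    ⟪laplacian m φ (nabla m φ) (meanCurvature m φ) q, tangentMapAt m φ q v⟫ =
      (m : ℝ) / 2 * mvfderiv (𝓡 m) (fun q : M => ‖meanCurvature m φ q‖ ^ 2) q v
        + 2 * ⟪traceG m φ q (fun u w =>
            weingarten m φ q (nablaN m φ (meanCurvature m φ) q u) w), tangentMapAt m φ q v⟫ := by
  have h1 := inner_laplacian_meanCurvature_symm hφ q (mem_extChartAt_target (I := 𝓡 m) q) hm
  rw [extChartAt_to_inv] at h1
  exact h1 v

theorem inner_meanCurvature_tangentMapAt (q : M) (v : TangentSpace (𝓡 m) q) :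
    ⟪meanCurvature m φ q, tangentMapAt m φ q v⟫ = 0 := by
  have h1 : meanCurvature m φ q ∈ (tangentPlane m φ q)ᗮ :=
    (Submodule.starProjection_apply_eq_zero_iff _).1 (tanProj_meanCurvature hφ q)
  have h2 : tangentMapAt m φ q v ∈ tangentPlane m φ q := ⟨v, rfl⟩
  exact Submodule.inner_left_of_mem_orthogonal h2 h1

omit hφ [IsManifold (𝓡 m) ∞ M] in
-- The complement of `T_q M` is taken in all of `ℝ^(n+1)`, so `w` need not be tangent to the sphere.
theorem eq_zero_iff_normal_tangential (q : M) (w : Ambient n) :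
    w = 0 ↔ w - tanProj m φ q w = 0 ∧
      ∀ v : TangentSpace (𝓡 m) q, ⟪w, tangentMapAt m φ q v⟫ = 0 := by
  constructor
  · rintro rfl
    exact ⟨by simp [tanProj], by simp⟩
  · rintro ⟨h1, h2⟩
    have h3 : w ∈ tangentPlane m φ q := by
      rw [sub_eq_zero.1 h1]; exact Submodule.starProjection_apply_mem _ _
    obtain ⟨v, hv⟩ := h3
    have h4 := h2 v
    change ⟪w, (tangentMapAt m φ q).toLinearMap v⟫ = 0 at h4
    rwa [hv, inner_self_eq_zero] at h4

end Global

end SphereSubmanifold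

end

/-! ### The characterization -/

theorem mainTheorem9 (m n : ℕ) {M : Type*} [TopologicalSpace M]
    [ChartedSpace (EuclideanSpace ℝ (Fin m)) M] [IsManifold (𝓡 m) ∞ M]
    (φ : M → SphereSubmanifold.UnitSphere n)
    (hφ : SphereSubmanifold.IsImmersedSubmanifold m φ) (k : ℝ) :
    SphereSubmanifold.IsBiharmonicOfIndex m φ k ↔
      (∀ p : M,
        SphereSubmanifold.laplacian m φ (SphereSubmanifold.nablaN m φ)
            (SphereSubmanifold.meanCurvature m φ) p
          - ((m : ℝ) - k) • SphereSubmanifold.meanCurvature m φ p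
          + SphereSubmanifold.traceG m φ p (fun u v =>
              SphereSubmanifold.secondFundamentalForm m φ p u
                (SphereSubmanifold.weingarten m φ p (SphereSubmanifold.meanCurvature m φ p) v)) = 0) ∧
      (∀ (p : M) (v : TangentSpace (𝓡 m) p),
        (m : ℝ) / 2 *
            mvfderiv (𝓡 m) (fun q : M => ‖SphereSubmanifold.meanCurvature m φ q‖ ^ 2) p v
          + 2 * inner ℝ
              (SphereSubmanifold.traceG m φ p (fun u w =>
                SphereSubmanifold.weingarten m φ p
                  (SphereSubmanifold.nablaN m φ (SphereSubmanifold.meanCurvature m φ) p u) w))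
              (SphereSubmanifold.tangentMapAt m φ p v) = 0) := by
  open SphereSubmanifold in
  have hbi : ∀ p, laplacian m φ (nabla m φ) (deltaT m φ) p - curvatureEnd m φ p (deltaT m φ p)
      + k • deltaT m φ p = (-(m : ℝ)) • (laplacian m φ (nabla m φ) (meanCurvature m φ) p
        - ((m : ℝ) - k) • meanCurvature m φ p) := by
    intro p
    rw [curvatureEnd_deltaT hφ, laplacian_deltaT hφ, deltaT_eq hφ]
    module
  rw [SphereSubmanifold.IsBiharmonicOfIndex]
  simp only [hbi]
  rcases eq_or_ne m 0 with hm | hm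
  -- In dimension zero all traces are empty and `H = 0`, so both sides hold trivially.
  · have hH : ∀ p, SphereSubmanifold.meanCurvature m φ p = 0 := fun p => by
      rw [SphereSubmanifold.meanCurvature, SphereSubmanifold.traceG_eq_zero hφ hm, smul_zero]
    have hm' : (m : ℝ) = 0 := by rw [hm, Nat.cast_zero]
    simp [hm', hH, SphereSubmanifold.laplacian, SphereSubmanifold.traceG_eq_zero hφ hm]
  · have hm' : (-(m : ℝ)) ≠ 0 := neg_ne_zero.2 (Nat.cast_ne_zero.2 hm)
    rw [← forall_and]
    refine forall_congr' fun p => ?_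
    -- After cancelling `-m`, the field `ΔH - (m - k) H` is split; since `H` is normal, `(m - k) H`
    -- enters only the normal equation.
    rw [smul_eq_zero_iff_right hm', SphereSubmanifold.eq_zero_iff_normal_tangential (m := m) (φ := φ) p]
    refine and_congr ?_ (forall_congr' fun v => ?_)
    · have h1 := SphereSubmanifold.laplacian_meanCurvature_sub_tanProj hφ p
      have h2 := SphereSubmanifold.tanProj_meanCurvature hφ p
      rw [SphereSubmanifold.tanProj] at h1 h2
      rw [SphereSubmanifold.tanProj, map_sub, map_smul, h2, smul_zero, sub_zero, sub_right_comm, h1,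
        add_sub_right_comm]
    · rw [inner_sub_left, inner_smul_left,
        SphereSubmanifold.inner_meanCurvature_tangentMapAt hφ, mul_zero, sub_zero,
        SphereSubmanifold.inner_laplacian_meanCurvature hφ hm]
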